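/- Let $k$ be a non-archimedean local field of characteristic different from $2$ with ring of integers $R$. A lattice is a finitely generated $R$-submodule $L$ of a regular (finite-dimensional) quadratic space $(V,Q)$ over $k$ with $kL=V$; its rank is $\dim_k V$. Two lattices are isometric if some isometry between their quadratic spaces maps one onto the other. Put $\langle v,w\rangle=Q(v+w)-Q(v)-Q(w)$ and $L^\vee=\{v\in V:\langle v,w\rangle\in R\text{ for all }w\in L\}$. The lattice $L$ is called special if $Q(L)\subseteq R$, its rank is odd, and the $R$-module $L^\vee/L$ is cyclic. The determinant of $L$ is $\det L=(-1)^{\lfloor m/2\rfloor}\det(\langle v_i,v_j\rangle)$ for a basis $v_1,\dots,v_m$ of the free $R$-module $L$; it is well defined up to squares of units of $R$, and $L$ has determinant $d$ if $\det L=d$ for some basis. The Eichler invariant $e(L)$ of a special lattice $L$ of determinant $2N$ is $1$ if $4N\,Q(v)=1$ for some $v\in L^\vee$, and $-1$ otherwise. Theorem. Let $n\ge 1$ be an integer, let $N\in R$ with $N\neq 0$, and let $e\in\{\pm1\}$, with $e=1$ if $N\in R^\times$. Then there is exactly one isometry class of special lattices of rank $2n+1$, determinant $2N$ and Eichler invariant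 $e$: such a lattice exists, and any two of them are isometric. -/

import Mathlib

open scoped ValuativeRel

universe u v w

namespace QuadraticLattice

variable {R : Type*} {k : Type*} {V : Type*} {W : Type*}
variable [CommRing R] [Field k] [Algebra R k]
variable [AddCommGroup V] [Module R V] [Module k V] [IsScalarTower R k V]
variable [AddCommGroup W] [Module R W] [Module k W] [IsScalarTower R k W]

/-- The dual lattice `L^∨ = {v | ⟨v, w⟩ ∈ R for all w ∈ L}`, where
`⟨v, w⟩ = Q (v + w) - Q v - Q w`. -/
def dual (Q : QuadraticForm k V) (L : Submodule R V) : Submodule R V :=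
  LinearMap.BilinForm.dualSubmodule Q.polarBilin L

/-- `L` is integral: `Q(L) ⊆ R`. -/
def IsIntegral (Q : QuadraticForm k V) (L : Submodule R V) : Prop :=
  ∀ x ∈ L, Q x ∈ Set.range (algebraMap R k)

/-- `L` is a special lattice on the quadratic space `(V, Q)`: the space is regular, `L` is a
lattice on `V` (finitely generated over `R`, spanning `V` over `k`), it is integral, of odd rank,
and `L^∨ / L` is a cyclic `R`-module. -/
structure IsSpecial (Q : QuadraticForm k V) (L : Submodule R V) : Prop where
  regular : Q.polarBilin.Nondegenerate
  isLattice : L.IsLattice k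
  integral : IsIntegral Q L
  odd_rank : Odd (Module.finrank k V)
  cyclic : (⊤ : Submodule R (dual Q L ⧸ L.submoduleOf (dual Q L))).IsPrincipal

/-- The signed determinant `(-1)^⌊m/2⌋ det ⟨b i, b j⟩` computed in a basis `b` of `L`. -/
noncomputable def signedDet (Q : QuadraticForm k V) {L : Submodule R V} {m : ℕ}
    (b : Module.Basis (Fin m) R L) : k :=
  (-1) ^ (m / 2) * (Matrix.of fun i j => Q.polarBilin (b i : V) (b j : V)).det

/-- The free lattice `L` has determinant `d`. The determinant of `L` is only defined up to squares
of units of `R`, and replacing one basis vector by a unit multiple of it realizes every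
representative, so this says that `d` is the signed determinant in some basis. -/
def HasDet (Q : QuadraticForm k V) (L : Submodule R V) (d : k) : Prop :=
  ∃ (m : ℕ) (b : Module.Basis (Fin m) R L), signedDet Q b = d

open Classical in
/-- The Eichler invariant of a lattice `L` of determinant `2 N`: it is `1` if `4 N Q(x) = 1` for
some `x ∈ L^∨`, and `-1` otherwise. (It does not change if `N` is multiplied by the square of a
unit.) -/
noncomputable def eichlerInvariant (Q : QuadraticForm k V) (L : Submodule R V) (N : R) : ℤˣ :=
  if ∃ x ∈ dual Q L, 4 * algebraMap R k N * Q x = 1 then 1 else -1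

/-- `L` is a special lattice of rank `r`, determinant `2 N` and Eichler invariant `e`. -/
def IsSpecialOfType (Q : QuadraticForm k V) (L : Submodule R V) (r : ℕ) (N : R) (e : ℤˣ) : Prop :=
  IsSpecial Q L ∧ Module.finrank k V = r ∧ HasDet Q L (2 * algebraMap R k N) ∧
    eichlerInvariant Q L N = e

/-- The lattices `L` on `(V, Q)` and `M` on `(W, P)` are isometric: some isometry of the quadratic
spaces `V ≃ W` maps `L` onto `M`. -/
def Isometric (Q : QuadraticForm k V) (L : Submodule R V)
    (P : QuadraticForm k W) (M : Submodule R W) : Prop :=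
  ∃ σ : Q.IsometryEquiv P, ∀ x : V, σ x ∈ M ↔ x ∈ L

end QuadraticLattice

/-!
Let `c` be such that `t ^ 2 + t + c` has no root modulo the maximal ideal. Modulo that ideal the
polar form of an integral form with cyclic discriminant module drops in rank by at most one, and a
quadratic form in three variables over a finite field has a nontrivial zero. Hensel's lemma
therefore splits off hyperbolic planes until the rank is three, and then one more binary form
`x ^ 2 + x * y + ε * y ^ 2` with `ε = 0` or `ε = c`. What remains is `a * z ^ 2`, and if `a` is a
unit the last three variables contain a hyperbolic plane, so that one may take `ε = 0`.

The determinant fixes `a` up to squares of units. Since the form in the first `2 * n` variables is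
unimodular, the Eichler invariant is `1` exactly when `4 * δ * N * p u + t ^ 2 = δ` is solvable,
where `δ = 1 - 4 * ε` and `p` is that form. For `ε = 0` take `u = 0` and `t = 1`; for `ε = c` a
solution would give a root of `s ^ 2 + s + c` modulo the maximal ideal.
-/

namespace QuadraticLattice

section FiniteField

open Polynomial
open scoped Matrix

variable {F : Type*} [Field F] [Finite F]

theorem exists_ne_zero_dotProduct_mulVec_eq_zero {ι : Type*} [Fintype ι]
    (hι : 3 ≤ Fintype.card ι) (A : Matrix ι ι F) : ∃ x : ι → F, x ≠ 0 ∧ x ⬝ᵥ A *ᵥ x = 0 := by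
  classical
  have := Fintype.ofFinite F
  obtain ⟨p, hp⟩ := CharP.exists F
  let f : MvPolynomial ι F :=
    ∑ i, ∑ j, MvPolynomial.C (A i j) * (MvPolynomial.X i * MvPolynomial.X j)
  have eval_f (x : ι → F) : MvPolynomial.eval x f = x ⬝ᵥ A *ᵥ x := by
    simp only [f, map_sum, map_mul, MvPolynomial.eval_C, MvPolynomial.eval_X, dotProduct,
      Matrix.mulVec, Finset.mul_sum]
    exact Finset.sum_congr rfl fun i _ => Finset.sum_congr rfl fun j _ => by ring
  have homogeneous : f.IsHomogeneous 2 :=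
    .sum _ _ _ fun i _ => .sum _ _ _ fun j _ =>
      ((MvPolynomial.isHomogeneous_X F i).mul (MvPolynomial.isHomogeneous_X F j)).C_mul _
  have dvd_card := char_dvd_card_solutions p (f := f) (by have := homogeneous.totalDegree_le; lia)
  let zero : {x // MvPolynomial.eval x f = 0} := ⟨0, by rw [eval_f, zero_dotProduct]⟩
  have : Nontrivial {x // MvPolynomial.eval x f = 0} := by
    rw [← Fintype.one_lt_card_iff_nontrivial]
    have card_pos := Fintype.card_pos_iff.mpr ⟨zero⟩
    have card_ne_one : Fintype.card {x // MvPolynomial.eval x f = 0} ≠ 1 := fun h =>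
      CharP.char_ne_one F p (Nat.dvd_one.mp (h ▸ dvd_card))
    lia
  obtain ⟨⟨x, hx⟩, x_ne_zero⟩ := exists_ne zero
  exact ⟨x, fun h => x_ne_zero (Subtype.ext h), by rw [← eval_f, hx]⟩

theorem exists_forall_sq_add_self_add_ne_zero (F : Type*) [Field F] [Finite F] :
    ∃ c : F, ∀ t : F, t ^ 2 + t + c ≠ 0 := by
  have not_injective : ¬ Function.Injective fun t : F => -(t ^ 2 + t) := fun h => by
    simpa using @h 0 (-1) (by simp)
  rw [Finite.injective_iff_surjective] at not_injective
  simp only [Function.Surjective, not_forall, not_exists] at not_injective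
  obtain ⟨c, hc⟩ := not_injective
  exact ⟨c, fun t ht => hc t (by linear_combination -ht)⟩

theorem irreducible_X_sq_add_X_add_C {K : Type*} [Field K] {c : K}
    (hc : ∀ t : K, t ^ 2 + t + c ≠ 0) : Irreducible (X ^ 2 + X + C c) := by
  have hdeg : (X ^ 2 + X + C c).natDegree = 2 := by compute_degree!
  rw [irreducible_iff_roots_eq_zero_of_degree_le_three hdeg.ge (by lia)]
  refine Multiset.eq_zero_of_forall_notMem fun t ht => hc t ?_
  simpa using isRoot_of_mem_roots ht

theorem exists_extension_sq_add_self_add_eq_zero {c : F} (hc : ∀ t : F, t ^ 2 + t + c ≠ 0)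
    (p : ℕ) [Fact p.Prime] [CharP F p] :
    ∃ α : FiniteField.Extension F p 2, α ^ 2 + α + algebraMap F _ c = 0 := by
  have : Fact (Irreducible (X ^ 2 + X + C c)) := ⟨irreducible_X_sq_add_X_add_C hc⟩
  have hdeg : (X ^ 2 + X + C c).natDegree = 2 := by compute_degree!
  let φ := FiniteField.algEquivExtension F p 2 (AdjoinRoot (X ^ 2 + X + C c))
    ((finrank_quotient_span_eq_natDegree (f := X ^ 2 + X + C c)).trans hdeg)
  have hroot := congrArg φ (AdjoinRoot.eval₂_root (X ^ 2 + X + C c))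
  exact ⟨φ (AdjoinRoot.root _), by simpa [← AdjoinRoot.algebraMap_eq] using hroot⟩

theorem exists_sq_add_self_add_eq_mul_sq {c d : F} (hc : ∀ t : F, t ^ 2 + t + c ≠ 0)
    (hd : ∀ t : F, t ^ 2 + t + d ≠ 0) : ∃ s : F, s ^ 2 + s + d = c * (2 * s + 1) ^ 2 := by
  obtain ⟨p, hp⟩ := CharP.exists F
  have : Fact p.Prime := ⟨CharP.char_is_prime F p⟩
  obtain ⟨α, hα⟩ := exists_extension_sq_add_self_add_eq_zero hc p
  obtain ⟨β, hβ⟩ := exists_extension_sq_add_self_add_eq_zero hd p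
  have indep : LinearIndependent F ![1, α] := by
    refine (LinearIndependent.pair_iff' one_ne_zero).2 fun t ht => hc t ?_
    rw [← Algebra.algebraMap_eq_smul_one] at ht
    apply FaithfulSMul.algebraMap_injective F (FiniteField.Extension F p 2)
    simpa [← ht] using hα
  have spans : β ∈ Submodule.span F (Set.range ![1, α]) := by
    rw [indep.span_eq_top_of_card_eq_finrank' (by simp [FiniteField.finrank_extension])]
    trivial
  -- Compare coefficients in `β² + β + d = 0` for `β = x + y α`: those of `α` give `y = 2 x + 1`.
  obtain ⟨y, x, rfl⟩ := Submodule.mem_span_pair.1 (by simpa using spans)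
  simp only [Algebra.smul_def, mul_one] at hβ
  obtain ⟨hx, hy⟩ := LinearIndependent.pair_iff.1 indep (x ^ 2 + x + d - c * y ^ 2)
    (y * (2 * x + 1 - y)) (by
      simp only [Algebra.smul_def, map_add, map_sub, map_mul, map_pow, map_one, map_ofNat]
      linear_combination hβ - algebraMap F _ y ^ 2 * hα)
  have y_ne_zero : y ≠ 0 := by
    rintro rfl
    exact hd x (by linear_combination hx)
  refine ⟨x, ?_⟩
  rw [sub_eq_zero.1 ((mul_eq_zero.1 hy).resolve_left y_ne_zero)]
  exact sub_eq_zero.1 hx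

end FiniteField

section QuadraticForm

open Module

variable {R M M' U U' : Type*} [CommRing R] [AddCommGroup M] [Module R M]
  [AddCommGroup M'] [Module R M'] [AddCommGroup U] [Module R U] [AddCommGroup U'] [Module R U']

theorem polarBilin_self (q : QuadraticForm R M) (x : M) : q.polarBilin x x = 2 * q x := by
  simp

theorem polarBilin_comm (q : QuadraticForm R M) (x y : M) :
    q.polarBilin x y = q.polarBilin y x := by
  simp [QuadraticMap.polar_comm q x y]

theorem map_add_eq_add_add_polarBilin (q : QuadraticForm R M) (x y : M) :
    q (x + y) = q x + q y + q.polarBilin x y :=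
  QuadraticMap.map_add q x y

theorem map_smul_add_smul (q : QuadraticForm R M) (r s : R) (x y : M) :
    q (r • x + s • y) = r ^ 2 * q x + r * s * q.polarBilin x y + s ^ 2 * q y := by
  rw [map_add_eq_add_add_polarBilin, QuadraticMap.map_smul, QuadraticMap.map_smul]
  simp only [map_smul, LinearMap.smul_apply, smul_eq_mul]
  ring

theorem polarBilin_map_map {q : QuadraticForm R M} {q' : QuadraticForm R M'} (φ : q →qᵢ q')
    (x y : M) : q'.polarBilin (φ x) (φ y) = q.polarBilin x y := by
  simp only [QuadraticMap.polarBilin_apply_apply, QuadraticMap.polar, ← map_add,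
    QuadraticMap.Isometry.map_app]

theorem equivalent_prod_assoc (p : QuadraticForm R U) (p' : QuadraticForm R U')
    (q : QuadraticForm R M) : (p.prod (p'.prod q)).Equivalent ((p.prod p').prod q) :=
  ⟨{ toLinearEquiv := (LinearEquiv.prodAssoc R U U' M).symm
     map_app' := fun _ => add_assoc _ _ _ }⟩

theorem equivalent_smul_sq_mul_sq (a : R) {u : R} (hu : IsUnit u) :
    (a • QuadraticMap.sq : QuadraticForm R R).Equivalent ((a * u ^ 2) • QuadraticMap.sq) := by
  refine QuadraticMap.Equivalent.symm ⟨{ toLinearEquiv := LinearEquiv.smulOfUnit hu.unit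
                                         map_app' := fun x => ?_ }⟩
  change a * (u * x * (u * x)) = a * u ^ 2 * (x * x)
  ring

theorem polarBilin_prod_smul_sq (p : QuadraticForm R U) (a : R) (z z' : U × R) :
    (p.prod (a • QuadraticMap.sq)).polarBilin z z' =
      p.polarBilin z.1 z'.1 + 2 * a * z.2 * z'.2 := by
  simp only [QuadraticMap.polarBilin_apply_apply, QuadraticMap.polar, QuadraticMap.prod_apply,
    smul_apply, QuadraticMap.sq_apply, Prod.fst_add, Prod.snd_add, smul_eq_mul]
  ring

theorem apply_eq_apply_add_mul_apply (f : U × R →ₗ[R] R) (z : U × R) :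
    f z = f (z.1, 0) + z.2 * f (0, 1) := by
  rw [← smul_eq_mul, ← map_smul, ← map_add]
  simp

/-- A quadratic form is unimodular if its polar form identifies the module with its dual. -/
def IsUnimodular (q : QuadraticForm R M) : Prop :=
  Function.Bijective (q.polarBilin : M → Dual R M)

/-- The cokernel of the map `M → Dual R M` given by the polar form is a cyclic module. For the form
of an integral lattice `L` this cokernel is the discriminant module `L^∨ / L`. -/
def HasCyclicDiscriminant (q : QuadraticForm R M) : Prop :=
  ∃ f₀ : Dual R M, ∀ f : Dual R M, ∃ (r : R) (x : M), f = r • f₀ + q.polarBilin x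

theorem HasCyclicDiscriminant.of_leftInverse {q : QuadraticForm R M} {q' : QuadraticForm R M'}
    (h : HasCyclicDiscriminant q) (i : M' →ₗ[R] M) (p : M →ₗ[R] M') (hpi : ∀ y, p (i y) = y)
    (hadj : ∀ x y, q.polarBilin x (i y) = q'.polarBilin (p x) y) : HasCyclicDiscriminant q' := by
  obtain ⟨f₀, h⟩ := h
  refine ⟨f₀ ∘ₗ i, fun f => ?_⟩
  obtain ⟨r, x, hx⟩ := h (f ∘ₗ p)
  refine ⟨r, p x, LinearMap.ext fun y => ?_⟩
  simpa [hpi, hadj] using LinearMap.congr_fun hx (i y)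

theorem HasCyclicDiscriminant.of_equivalent {q : QuadraticForm R M} {q' : QuadraticForm R M'}
    (h : HasCyclicDiscriminant q) (hq : q.Equivalent q') : HasCyclicDiscriminant q' := by
  obtain ⟨φ⟩ := hq
  refine h.of_leftInverse φ.symm.toLinearEquiv φ.toLinearEquiv
    φ.toLinearEquiv.apply_symm_apply fun x y => ?_
  rw [← polarBilin_map_map φ.toIsometry]
  exact congrArg (q'.polarBilin (φ x)) (φ.toLinearEquiv.apply_symm_apply y)

theorem HasCyclicDiscriminant.of_prod {q : QuadraticForm R M} {q' : QuadraticForm R M'}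
    (h : HasCyclicDiscriminant (q.prod q')) : HasCyclicDiscriminant q' :=
  h.of_leftInverse (LinearMap.inr R M M') (LinearMap.snd R M M') (fun _ => rfl) (by simp)

theorem IsUnimodular.hasCyclicDiscriminant_prod_smul_sq {p : QuadraticForm R U}
    (hp : IsUnimodular p) (a : R) : HasCyclicDiscriminant (p.prod (a • QuadraticMap.sq)) := by
  refine ⟨LinearMap.snd R U R, fun f => ?_⟩
  obtain ⟨u, hu⟩ := hp.2 (f ∘ₗ LinearMap.inl R U R)
  refine ⟨f (0, 1), (u, 0), LinearMap.ext fun ⟨v, r⟩ => ?_⟩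
  have huv : p.polarBilin u v = f (v, 0) := LinearMap.congr_fun hu v
  rw [apply_eq_apply_add_mul_apply, ← huv, LinearMap.add_apply, polarBilin_prod_smul_sq,
    LinearMap.smul_apply, LinearMap.snd_apply, smul_eq_mul]
  ring

theorem IsUnimodular.exists_equivalent_prod {p : QuadraticForm R U} {q : QuadraticForm R M}
    (hp : IsUnimodular p) (φ : p →qᵢ q) :
    ∃ N : Submodule R M, (p.prod (q.restrict N)).Equivalent q := by
  let polarEquiv : U ≃ₗ[R] Dual R U := LinearEquiv.ofBijective p.polarBilin hp
  let proj : M →ₗ[R] U :=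
    polarEquiv.symm.toLinearMap ∘ₗ q.polarBilin.compl₂ φ.toLinearMap
  have polarBilin_proj (x : M) (u : U) : p.polarBilin (proj x) u = q.polarBilin x (φ u) :=
    LinearMap.congr_fun (polarEquiv.apply_symm_apply _) u
  have proj_map (u : U) : proj (φ u) = u := polarEquiv.injective <| LinearMap.ext fun v => by
    exact (polarBilin_proj _ v).trans (polarBilin_map_map φ u v)
  let e : (U × LinearMap.ker proj) ≃ₗ[R] M :=
    { φ.toLinearMap.coprod (LinearMap.ker proj).subtype with
      invFun := fun x => (proj x, ⟨x - φ (proj x), by simp [proj_map]⟩)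
      left_inv := fun ⟨u, y⟩ => by
        ext <;> simp [proj_map]
      right_inv := fun x => by simp }
  refine ⟨LinearMap.ker proj, ⟨{ toLinearEquiv := e, map_app' := fun ⟨u, y⟩ => ?_ }⟩⟩
  have orthogonal : q.polarBilin (φ u) y = 0 := by
    rw [polarBilin_comm, ← polarBilin_proj, LinearMap.mem_ker.1 y.2, map_zero,
      LinearMap.zero_apply]
  change q (φ u + y) = p u + q y
  rw [map_add_eq_add_add_polarBilin, orthogonal, φ.map_app, add_zero]

end QuadraticForm

section GramDeterminant

open Module

variable {R M M' : Type*} [CommRing R] [AddCommGroup M] [Module R M]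
  [AddCommGroup M'] [Module R M']

/-- The quadratic form `q` has Gram determinant `d` if `d = det ⟨b i, b j⟩` for some basis `b`. -/
def HasGramDet (q : QuadraticForm R M) (d : R) : Prop :=
  ∃ (m : ℕ) (b : Basis (Fin m) R M), (LinearMap.BilinForm.toMatrix b q.polarBilin).det = d

theorem hasGramDet_det_toMatrix {ι : Type*} [Fintype ι] [DecidableEq ι] (b : Basis ι R M)
    (q : QuadraticForm R M) : HasGramDet q (LinearMap.BilinForm.toMatrix b q.polarBilin).det := by
  refine ⟨_, b.reindex (Fintype.equivFin ι), ?_⟩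
  rw [← Matrix.det_submatrix_equiv_self (Fintype.equivFin ι).symm]
  congr 1
  ext i j
  simp [LinearMap.BilinForm.toMatrix_apply]

theorem HasGramDet.of_equivalent {q : QuadraticForm R M} {q' : QuadraticForm R M'} {d : R}
    (h : HasGramDet q d) (hq : q.Equivalent q') : HasGramDet q' d := by
  obtain ⟨m, b, rfl⟩ := h
  obtain ⟨φ⟩ := hq
  refine ⟨m, b.map φ.toLinearEquiv, congrArg Matrix.det ?_⟩
  ext i j
  simpa [LinearMap.BilinForm.toMatrix_apply] using polarBilin_map_map φ.toIsometry (b i) (b j)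

theorem HasGramDet.prod {q : QuadraticForm R M} {q' : QuadraticForm R M'} {d d' : R}
    (h : HasGramDet q d) (h' : HasGramDet q' d') : HasGramDet (q.prod q') (d * d') := by
  obtain ⟨m, b, rfl⟩ := h
  obtain ⟨m', b', rfl⟩ := h'
  convert hasGramDet_det_toMatrix (b.prod b') (q.prod q')
  rw [← Matrix.det_fromBlocks_zero₂₁ _ 0]
  congr 1
  ext (i | i) (j | j) <;> simp [LinearMap.BilinForm.toMatrix_apply]

theorem hasGramDet_smul_sq (a : R) :
    HasGramDet (a • QuadraticMap.sq : QuadraticForm R R) (2 * a) := by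
  convert hasGramDet_det_toMatrix (Basis.singleton (Fin 1) R) (a • QuadraticMap.sq)
  rw [Matrix.det_fin_one, LinearMap.BilinForm.toMatrix_apply, polarBilin_self]
  simp

theorem HasGramDet.exists_eq_sq_mul [Nontrivial R] {q : QuadraticForm R M} {d d' : R}
    (h : HasGramDet q d) (h' : HasGramDet q d') : ∃ u : R, IsUnit u ∧ d' = u ^ 2 * d := by
  obtain ⟨m, b, rfl⟩ := h
  obtain ⟨m', b', rfl⟩ := h'
  obtain rfl : m = m' := by simpa using Fintype.card_congr (b.indexEquiv b')
  refine ⟨b.det b', b.isUnit_det b', ?_⟩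
  rw [← LinearMap.BilinForm.toMatrix_mul_basis_toMatrix b b', Matrix.det_mul, Matrix.det_mul,
    Matrix.det_transpose, Basis.det_apply]
  ring

theorem HasGramDet.isUnimodular {q : QuadraticForm R M} {d : R} (h : HasGramDet q d)
    (hd : IsUnit d) : IsUnimodular q := by
  obtain ⟨m, b, rfl⟩ := h
  have : LinearMap.BilinForm.toMatrix b q.polarBilin =
      LinearMap.toMatrix b b.dualBasis q.polarBilin := by
    ext i j
    rw [LinearMap.BilinForm.toMatrix_apply, LinearMap.toMatrix_apply, Basis.dualBasis_repr,
      polarBilin_comm]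
  exact (LinearEquiv.ofIsUnitDet (this ▸ hd)).bijective

end GramDeterminant

section ModelForm

open Module

variable {R M : Type*} [CommRing R] [AddCommGroup M] [Module R M]

/-- The binary quadratic form `x² + xy + c y²`. For `c = 0` it is a hyperbolic plane, and if
`t² + t + c` has no root modulo the maximal ideal then it is anisotropic modulo that ideal. -/
def binaryForm (c : R) : QuadraticForm R (R × R) :=
  QuadraticMap.sq.comp (LinearMap.fst R R R) +
    QuadraticMap.linMulLin (LinearMap.fst R R R) (LinearMap.snd R R R) +
    c • QuadraticMap.sq.comp (LinearMap.snd R R R)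

@[simp]
theorem binaryForm_apply (c : R) (x : R × R) :
    binaryForm c x = x.1 ^ 2 + x.1 * x.2 + c * x.2 ^ 2 := by
  simp [binaryForm, sq]

theorem polarBilin_binaryForm (c : R) (x y : R × R) :
    (binaryForm c).polarBilin x y =
      2 * x.1 * y.1 + x.1 * y.2 + x.2 * y.1 + 2 * c * x.2 * y.2 := by
  simp only [QuadraticMap.polarBilin_apply_apply, QuadraticMap.polar, binaryForm_apply,
    Prod.fst_add, Prod.snd_add]
  ring

theorem hasGramDet_binaryForm (c : R) : HasGramDet (binaryForm c) (4 * c - 1) := by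
  convert hasGramDet_det_toMatrix (Basis.finTwoProd R) (binaryForm c)
  simp only [Matrix.det_fin_two, LinearMap.BilinForm.toMatrix_apply, polarBilin_binaryForm,
    Basis.finTwoProd_zero, Basis.finTwoProd_one]
  ring

theorem isUnimodular_binaryForm {c : R} (hc : IsUnit (1 - 4 * c)) :
    IsUnimodular (binaryForm c) :=
  (hasGramDet_binaryForm c).isUnimodular (neg_sub 1 (4 * c) ▸ hc.neg)

theorem nonempty_isometry_binaryForm {q : QuadraticForm R M} {e f : M} {c : R} (he : q e = 1)
    (hef : q.polarBilin e f = 1) (hf : q f = c) : Nonempty (binaryForm c →qᵢ q) :=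
  ⟨{ toLinearMap := (LinearMap.toSpanSingleton R M e).coprod (LinearMap.toSpanSingleton R M f)
     map_app' := fun x => by
      simp [map_smul_add_smul, he, hef, hf, binaryForm_apply, mul_comm] }⟩

/-- The orthogonal sum of `m` hyperbolic planes. -/
def hyperbolicForm (R : Type*) [CommRing R] (m : ℕ) : QuadraticForm R (Fin m → R × R) :=
  QuadraticMap.pi fun _ => binaryForm 0

theorem hyperbolicForm_succ_equivalent (m : ℕ) :
    ((binaryForm 0).prod (hyperbolicForm R m)).Equivalent (hyperbolicForm R (m + 1)) :=
  ⟨{ toLinearEquiv := Fin.consLinearEquiv R fun _ : Fin (m + 1) => R × R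
     map_app' := fun x => by
      change hyperbolicForm R (m + 1) (Fin.cons x.1 x.2) = _
      simp [hyperbolicForm, Fin.sum_univ_succ, QuadraticMap.pi_apply] }⟩

theorem hasGramDet_hyperbolicForm (m : ℕ) : HasGramDet (hyperbolicForm R m) ((-1) ^ m) := by
  induction m with
  | zero => exact ⟨0, Basis.empty _, by simp⟩
  | succ m ih =>
    convert ((hasGramDet_binaryForm 0).prod ih).of_equivalent (hyperbolicForm_succ_equivalent m)
      using 1
    ring

/-- The orthogonal sum of `m` hyperbolic planes and a binary form `x² + xy + ε y²`. -/
def evenForm (m : ℕ) (ε : R) : QuadraticForm R ((Fin m → R × R) × R × R) :=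
  (hyperbolicForm R m).prod (binaryForm ε)

theorem evenForm_zero_equivalent (ε : R) : (evenForm 0 ε).Equivalent (binaryForm ε) :=
  ⟨{ toLinearEquiv := LinearEquiv.uniqueProd
     map_app' := fun x => by simp [evenForm, hyperbolicForm, QuadraticMap.pi_apply] }⟩

theorem evenForm_succ_equivalent (m : ℕ) (ε : R) :
    ((binaryForm 0).prod (evenForm m ε)).Equivalent (evenForm (m + 1) ε) :=
  (equivalent_prod_assoc _ _ _).trans (.prod (hyperbolicForm_succ_equivalent m) (.refl _))

theorem hasGramDet_evenForm (m : ℕ) (ε : R) :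
    HasGramDet (evenForm m ε) ((-1) ^ (m + 1) * (1 - 4 * ε)) := by
  have h : HasGramDet (evenForm m ε) ((-1) ^ m * (4 * ε - 1)) :=
    (hasGramDet_hyperbolicForm m).prod (hasGramDet_binaryForm ε)
  convert h using 1
  ring

theorem isUnimodular_evenForm (m : ℕ) {ε : R} (hε : IsUnit (1 - 4 * ε)) :
    IsUnimodular (evenForm m ε) :=
  (hasGramDet_evenForm m ε).isUnimodular ((isUnit_one.neg.pow _).mul hε)

/-- The normal form of a special lattice of rank `2 m + 3` and determinant `2 N`. The coefficient
of the last square makes the signed determinant equal to `2 N` up to the square of `1 - 4 ε`. -/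
def modelForm (m : ℕ) (ε N : R) : QuadraticForm R (((Fin m → R × R) × R × R) × R) :=
  (evenForm m ε).prod (((1 - 4 * ε) * N) • QuadraticMap.sq)

theorem hasGramDet_modelForm (m : ℕ) {ε : R} (hε : IsUnit (1 - 4 * ε)) (N : R) :
    HasGramDet (modelForm m ε N) ((-1) ^ (m + 1) * (2 * N)) := by
  obtain ⟨u, hu⟩ := hε.exists_right_inv
  have gram := (hasGramDet_evenForm m ε).prod (hasGramDet_smul_sq ((1 - 4 * ε) * N * u ^ 2))
  have rescale : ((evenForm m ε).prod (((1 - 4 * ε) * N * u ^ 2) • QuadraticMap.sq)).Equivalent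
      (modelForm m ε N) :=
    .prod (.refl _) (equivalent_smul_sq_mul_sq _ (.of_mul_eq_one_right _ hu)).symm
  convert gram.of_equivalent rescale using 1
  linear_combination -(-1) ^ (m + 1) * (2 * N) * (1 + (1 - 4 * ε) * u) * hu

end ModelForm

section Henselian

open IsLocalRing

variable {R : Type*} [CommRing R] [HenselianLocalRing R]

theorem exists_sq_add_mul_add_eq_zero {b c t : R} (h : residue R (t ^ 2 + b * t + c) = 0)
    (h' : IsUnit (2 * t + b)) :
    ∃ s : R, s ^ 2 + b * s + c = 0 ∧ residue R s = residue R t := by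
  have monic : (Polynomial.X ^ 2 + Polynomial.C b * Polynomial.X + Polynomial.C c).Monic := by
    monicity!
  obtain ⟨s, hs, hst⟩ := HenselianLocalRing.is_henselian _ monic t
    (by rw [← residue_eq_zero_iff]; simpa using h) (by simpa [one_add_one_eq_two] using h')
  refine ⟨s, by simpa [Polynomial.IsRoot] using hs, ?_⟩
  rwa [← residue_eq_zero_iff, map_sub, sub_eq_zero] at hst

/-- The small root of `a t² + b t + c` is `c / s`, where `s` is the root of the monic polynomial
`s² + b s + a c` that is close to `-b`. -/
theorem exists_mul_sq_add_mul_add_eq_zero (a : R) {b c : R} (hb : IsUnit b)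
    (hc : residue R c = 0) : ∃ t : R, a * t ^ 2 + b * t + c = 0 ∧ residue R t = 0 := by
  obtain ⟨s, hs, hsb⟩ := exists_sq_add_mul_add_eq_zero (b := b) (c := a * c) (t := -b)
    (by simp [hc, sq]) (by convert hb.neg using 1; ring)
  have s_isUnit : IsUnit s := by
    rw [← residue_ne_zero_iff_isUnit, hsb, residue_ne_zero_iff_isUnit]
    exact hb.neg
  obtain ⟨s', hs'⟩ := s_isUnit.exists_right_inv
  refine ⟨c * s', ?_, by simp [hc]⟩
  linear_combination c * s' ^ 2 * hs - c * (s * s' + 1 + b * s') * hs'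

variable {M : Type*} [AddCommGroup M] [Module R M]

theorem exists_map_add_smul_eq (q : QuadraticForm R M) {v w : M} {d : R}
    (hv : residue R (q v) = residue R d) (hvw : IsUnit (q.polarBilin v w)) :
    ∃ t : R, q (v + t • w) = d ∧ residue R t = 0 := by
  obtain ⟨t, ht, ht0⟩ := exists_mul_sq_add_mul_add_eq_zero (q w) (c := q v - d) hvw
    (by rw [map_sub, hv, sub_self])
  refine ⟨t, ?_, ht0⟩
  have expand := map_smul_add_smul q 1 t v w
  rw [one_smul] at expand
  linear_combination expand + ht

end Henselian

section Plane

variable {R M : Type*} [CommRing R] [AddCommGroup M] [Module R M]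

/-- The discriminant `⟨v, w⟩² - 4 q(v) q(w)` of the form `q (x v + y w)` in `x` and `y`. -/
def planeDiscr (q : QuadraticForm R M) (v w : M) : R :=
  discrim (q v) (q.polarBilin v w) (q w)

theorem planeDiscr_comm (q : QuadraticForm R M) (v w : M) :
    planeDiscr q v w = planeDiscr q w v := by
  rw [planeDiscr, planeDiscr, discrim, discrim, polarBilin_comm]
  ring

theorem planeDiscr_smul_add_smul_left (q : QuadraticForm R M) (x y : R) (v w : M) :
    planeDiscr q (x • v + y • w) w = x ^ 2 * planeDiscr q v w := by
  simp only [planeDiscr, discrim, map_smul_add_smul, map_add, map_smul, LinearMap.add_apply,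
    LinearMap.smul_apply, smul_eq_mul, polarBilin_self]
  ring

theorem planeDiscr_smul_add_smul_right (q : QuadraticForm R M) (x y : R) (v w : M) :
    planeDiscr q v (x • v + y • w) = y ^ 2 * planeDiscr q v w := by
  rw [planeDiscr_comm, add_comm, planeDiscr_smul_add_smul_left, planeDiscr_comm]

theorem planeDiscr_binaryForm (c : R) : planeDiscr (binaryForm c) (1, 0) (0, 1) = 1 - 4 * c := by
  simp only [planeDiscr, discrim, polarBilin_binaryForm, binaryForm_apply]
  ring

theorem planeDiscr_eq_neg_det_toMatrix (q : QuadraticForm R M) (b : Module.Basis (Fin 2) R M) :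
    planeDiscr q (b 0) (b 1) = -(LinearMap.BilinForm.toMatrix b q.polarBilin).det := by
  simp only [Matrix.det_fin_two, LinearMap.BilinForm.toMatrix_apply, planeDiscr, discrim,
    polarBilin_self, polarBilin_comm q (b 1)]
  ring

theorem exists_isUnit_planeDiscr {q : QuadraticForm R M} {v w : M} {x y : R}
    (hvw : IsUnit (planeDiscr q v w)) (hxy : IsUnit x ∨ IsUnit y) :
    ∃ w' : M, IsUnit (planeDiscr q (x • v + y • w) w') := by
  rcases hxy with hx | hy
  · exact ⟨w, planeDiscr_smul_add_smul_left q x y v w ▸ (hx.pow 2).mul hvw⟩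
  · refine ⟨v, ?_⟩
    rw [planeDiscr_comm, planeDiscr_smul_add_smul_right]
    exact (hy.pow 2).mul hvw

end Plane

section LocalPlane

open IsLocalRing

variable {R M : Type*} [CommRing R] [AddCommGroup M] [Module R M]

theorem isUnit_polarBilin_or_isUnit_two_mul [IsLocalRing R] {q : QuadraticForm R M} {v w : M}
    (hvw : IsUnit (planeDiscr q v w)) : IsUnit (q.polarBilin v w) ∨ IsUnit (2 * q v) := by
  simp only [← residue_ne_zero_iff_isUnit] at hvw ⊢
  by_contra! h
  apply hvw
  have factor : planeDiscr q v w = q.polarBilin v w ^ 2 - 2 * q v * (2 * q w) := by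
    rw [planeDiscr, discrim]
    ring
  rw [factor, map_sub, map_pow, map_mul, h.1, h.2]
  ring

theorem exists_isUnit_polarBilin [IsLocalRing R] {q : QuadraticForm R M} {v w : M}
    (hvw : IsUnit (planeDiscr q v w)) : ∃ w' : M, IsUnit (q.polarBilin v w') :=
  (isUnit_polarBilin_or_isUnit_two_mul hvw).elim (fun h => ⟨w, h⟩)
    fun h => ⟨v, by rwa [polarBilin_self]⟩

variable [HenselianLocalRing R]

theorem nonempty_isometry_binaryForm_zero {q : QuadraticForm R M} {v w : M}
    (hv : residue R (q v) = 0) (hvw : IsUnit (q.polarBilin v w)) :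
    Nonempty (binaryForm 0 →qᵢ q) := by
  obtain ⟨t, ht, ht0⟩ := exists_map_add_smul_eq q (d := 0) (by rw [hv, map_zero]) hvw
  set f := v + t • w
  have hfw : IsUnit (q.polarBilin f w) := by
    have expand : q.polarBilin f w = q.polarBilin v w + t * (2 * q w) := by
      simp only [f, ← polarBilin_self, map_add, LinearMap.add_apply, map_smul,
        LinearMap.smul_apply, smul_eq_mul]
    rw [← residue_ne_zero_iff_isUnit] at hvw ⊢
    rwa [expand, map_add, map_mul, ht0, zero_mul, add_zero]
  obtain ⟨r, hr⟩ := hfw.exists_right_inv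
  refine nonempty_isometry_binaryForm (e := (1 - q w * r ^ 2) • f + r • w) (f := f) ?_ ?_ ht
  · rw [map_smul_add_smul, ht]
    linear_combination (1 - q w * r ^ 2) * hr
  · rw [polarBilin_comm, map_add, map_smul, map_smul, polarBilin_self, ht, smul_eq_mul,
      smul_eq_mul]
    linear_combination hr

theorem nonempty_isometry_binaryForm_zero_of_planeDiscr {q : QuadraticForm R M} {v w : M}
    (hv : residue R (q v) = 0) (hvw : IsUnit (planeDiscr q v w)) :
    Nonempty (binaryForm 0 →qᵢ q) := by
  obtain ⟨w', hw'⟩ := exists_isUnit_polarBilin hvw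
  exact nonempty_isometry_binaryForm_zero hv hw'

theorem exists_map_eq_and_isUnit_planeDiscr {q : QuadraticForm R M} {v w : M} {a : R}
    (hv : residue R (q v) = residue R a) (hvw : IsUnit (planeDiscr q v w)) :
    ∃ v' : M, q v' = a ∧ IsUnit (planeDiscr q v' w) := by
  rcases isUnit_polarBilin_or_isUnit_two_mul hvw with hB | hB
  · obtain ⟨t, ht, -⟩ := exists_map_add_smul_eq q hv hB
    refine ⟨v + t • w, ht, ?_⟩
    have unchanged := planeDiscr_smul_add_smul_left q 1 t v w
    rw [one_smul, one_pow, one_mul] at unchanged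
    rwa [unchanged]
  · rw [← polarBilin_self] at hB
    obtain ⟨t, ht, ht0⟩ := exists_map_add_smul_eq q hv hB
    have one_add : IsUnit (1 + t) := by
      rw [← residue_ne_zero_iff_isUnit, map_add, ht0]
      simp
    refine ⟨v + t • v, ht, ?_⟩
    have scaled := planeDiscr_smul_add_smul_left q (1 + t) 0 v w
    rw [add_smul, one_smul, zero_smul, add_zero] at scaled
    rw [scaled]
    exact (one_add.pow 2).mul hvw

theorem exists_nonempty_isometry_binaryForm {q : QuadraticForm R M} {v w : M} (hv : q v = 1)
    (hvw : IsUnit (planeDiscr q v w)) :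
    ∃ d : R, IsUnit (1 - 4 * d) ∧ Nonempty (binaryForm d →qᵢ q) := by
  obtain ⟨s, u, hu, hsu⟩ : ∃ s u : R, IsUnit u ∧ 2 * s + u * q.polarBilin v w = 1 := by
    rcases isUnit_polarBilin_or_isUnit_two_mul hvw with hB | h2
    · obtain ⟨r, hr⟩ := hB.exists_left_inv
      exact ⟨0, r, .of_mul_eq_one _ hr, by rw [hr]; ring⟩
    · rw [hv, mul_one] at h2
      obtain ⟨r, hr⟩ := h2.exists_right_inv
      exact ⟨r * (1 - q.polarBilin v w), 1, isUnit_one,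
        by linear_combination (1 - q.polarBilin v w) * hr⟩
  have polar_eq_one : q.polarBilin v (s • v + u • w) = 1 := by
    rw [map_add, map_smul, map_smul, polarBilin_self, hv, smul_eq_mul, smul_eq_mul]
    linear_combination hsu
  refine ⟨q (s • v + u • w), ?_, nonempty_isometry_binaryForm hv polar_eq_one rfl⟩
  have discr_eq : 1 - 4 * q (s • v + u • w) = u ^ 2 * planeDiscr q v w := by
    rw [← planeDiscr_smul_add_smul_right, planeDiscr, discrim, hv, polar_eq_one]
    ring
  exact discr_eq ▸ (hu.pow 2).mul hvw

end LocalPlane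

section FiniteResidueField

open IsLocalRing
open scoped Matrix

theorem isUnit_one_sub_four_mul {R : Type*} [CommRing R] {c : R}
    (hc : ∀ t : R, IsUnit (t ^ 2 + t + c)) : IsUnit (1 - 4 * c) := by
  have factor : (-2 * c) ^ 2 + -2 * c + c = -c * (1 - 4 * c) := by ring
  exact isUnit_of_mul_isUnit_right (factor ▸ hc (-2 * c))

theorem isUnit_one_sub_four_mul_of_eq_zero_or_eq {R : Type*} [CommRing R] {c ε : R}
    (hc : ∀ t : R, IsUnit (t ^ 2 + t + c)) (hε : ε = 0 ∨ ε = c) : IsUnit (1 - 4 * ε) := by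
  rcases hε with rfl | rfl
  · simp
  · exact isUnit_one_sub_four_mul hc

variable {R M : Type*} [CommRing R] [AddCommGroup M] [Module R M]

theorem exists_forall_isUnit_sq_add_self_add (R : Type*) [CommRing R] [IsLocalRing R]
    [Finite (ResidueField R)] : ∃ c : R, ∀ t : R, IsUnit (t ^ 2 + t + c) := by
  obtain ⟨c', hc'⟩ := exists_forall_sq_add_self_add_ne_zero (ResidueField R)
  obtain ⟨c, rfl⟩ := residue_surjective c'
  exact ⟨c, fun t => (residue_ne_zero_iff_isUnit _).1 (by simpa using hc' (residue R t))⟩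

theorem exists_residue_map_sum_smul_eq_zero [IsLocalRing R] [Finite (ResidueField R)] {ι : Type*}
    [Fintype ι] (hι : 3 ≤ Fintype.card ι) (q : QuadraticForm R M) (b : ι → M) :
    ∃ x : ι → R, residue R (q (∑ i, x i • b i)) = 0 ∧ ∃ i, IsUnit (x i) := by
  classical
  obtain ⟨B, hB⟩ := LinearMap.BilinMap.toQuadraticMap_surjective
    (q.comp (Fintype.linearCombination R b))
  have apply_eq (x : ι → R) : residue R (q (∑ i, x i • b i)) =
      (residue R ∘ x) ⬝ᵥ (LinearMap.toMatrix₂' R B).map (residue R) *ᵥ (residue R ∘ x) := by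
    have map_eq : q (∑ i, x i • b i) = x ⬝ᵥ LinearMap.toMatrix₂' R B *ᵥ x := by
      rw [← Matrix.toLinearMap₂'_apply', Matrix.toLinearMap₂'_toMatrix']
      exact (congrArg (· x) hB).symm
    rw [map_eq, RingHom.map_dotProduct]
    exact congrArg _ (funext fun i => RingHom.map_mulVec _ _ _ i)
  obtain ⟨x', x'_ne_zero, hx'⟩ := exists_ne_zero_dotProduct_mulVec_eq_zero hι
    ((LinearMap.toMatrix₂' R B).map (residue R))
  obtain ⟨x, rfl⟩ := residue_surjective.comp_left x'
  obtain ⟨i, hi⟩ := Function.ne_iff.1 x'_ne_zero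
  exact ⟨x, (apply_eq x).trans hx', i, (residue_ne_zero_iff_isUnit _).1 hi⟩

variable [HenselianLocalRing R] [Finite (ResidueField R)]

theorem exists_sq_add_self_add_eq_mul_sq_of_henselian {c d : R}
    (hc : ∀ t : R, IsUnit (t ^ 2 + t + c)) (hd : ∀ t : R, IsUnit (t ^ 2 + t + d)) :
    ∃ s : R, IsUnit (2 * s + 1) ∧ s ^ 2 + s + d = c * (2 * s + 1) ^ 2 := by
  have ne_zero {a : R} (ha : ∀ t : R, IsUnit (t ^ 2 + t + a)) (t : ResidueField R) :
      t ^ 2 + t + residue R a ≠ 0 := by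
    obtain ⟨t, rfl⟩ := residue_surjective t
    simpa using (residue_ne_zero_iff_isUnit _).2 (ha t)
  obtain ⟨s', hs'⟩ := exists_sq_add_self_add_eq_mul_sq (ne_zero hc) (ne_zero hd)
  obtain ⟨s, rfl⟩ := residue_surjective s'
  have two_mul_add_one (t : R) (ht : residue R t = residue R s) : IsUnit (2 * t + 1) := by
    rw [← residue_ne_zero_iff_isUnit]
    intro h
    rw [map_add, map_mul, ht, map_one, map_ofNat] at h
    exact ne_zero hd (residue R s) (by rw [hs', h]; ring)
  obtain ⟨r, hr⟩ := (isUnit_one_sub_four_mul hc).exists_right_inv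
  obtain ⟨t, ht, hts⟩ := exists_sq_add_mul_add_eq_zero (b := 1) (c := r * (d - c)) (t := s)
    (by
      have hr' := congrArg (residue R) hr
      simp only [map_mul, map_sub, map_one, map_ofNat, map_add, map_pow] at hr' hs' ⊢
      linear_combination residue R r * hs' - (residue R s ^ 2 + residue R s) * hr')
    (two_mul_add_one s rfl)
  refine ⟨t, two_mul_add_one t hts, ?_⟩
  linear_combination (1 - 4 * c) * ht - (d - c) * hr

theorem nonempty_isometry_binaryForm_binaryForm {c d : R} (hc : ∀ t : R, IsUnit (t ^ 2 + t + c))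
    (hd : IsUnit (1 - 4 * d)) :
    Nonempty (binaryForm 0 →qᵢ binaryForm d) ∨ Nonempty (binaryForm c →qᵢ binaryForm d) := by
  by_cases! hroot : ∃ t : R, residue R (t ^ 2 + t + d) = 0
  · obtain ⟨t, ht⟩ := hroot
    obtain ⟨w, hw⟩ := exists_isUnit_planeDiscr (x := t) (y := 1) (planeDiscr_binaryForm d ▸ hd)
      (.inr isUnit_one)
    exact .inl (nonempty_isometry_binaryForm_zero_of_planeDiscr (by simpa using ht) hw)
  · obtain ⟨s, hs, heq⟩ := exists_sq_add_self_add_eq_mul_sq_of_henselian hc fun t =>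
      (residue_ne_zero_iff_isUnit _).1 (hroot t)
    obtain ⟨r, hr⟩ := hs.exists_right_inv
    refine .inr (nonempty_isometry_binaryForm (e := (1, 0)) (f := (r * s, r)) (by simp) ?_ ?_)
    · rw [polarBilin_binaryForm]
      linear_combination hr
    · rw [binaryForm_apply]
      linear_combination r ^ 2 * heq + c * ((2 * s + 1) * r + 1) * hr

theorem nonempty_isometry_binaryForm_zero_or_exists_map_eq {q : QuadraticForm R M} {e f : M}
    (hef : IsUnit (planeDiscr q e f)) (d : R) (hd : IsUnit d) :
    Nonempty (binaryForm 0 →qᵢ q) ∨ ∃ v w : M, q v = d ∧ IsUnit (planeDiscr q v w) := by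
  obtain ⟨x, hx, hunit⟩ := exists_residue_map_sum_smul_eq_zero (ι := Fin 3) (by simp)
    (q.prod ((-d) • QuadraticMap.sq)) ![(e, 0), (f, 0), (0, 1)]
  set v := x 0 • e + x 1 • f
  replace hx : residue R (q v) = residue R (d * x 2 ^ 2) := by
    rw [← sub_eq_zero, ← map_sub, ← hx]
    simp [Fin.sum_univ_three, v, sq, sub_eq_add_neg]
  by_cases hx2 : IsUnit (x 2)
  · obtain ⟨r, hr⟩ := hx2.exists_left_inv
    have hxy : IsUnit (x 0) ∨ IsUnit (x 1) := by
      simp only [← residue_ne_zero_iff_isUnit] at hx2 hd ⊢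
      by_contra! h
      refine mul_ne_zero hd (pow_ne_zero 2 hx2) ?_
      rw [← map_pow, ← map_mul, ← hx, map_smul_add_smul]
      simp [h.1, h.2]
    obtain ⟨w, hw⟩ := exists_isUnit_planeDiscr hef hxy
    have hrv : residue R (q (r • v)) = residue R d := by
      rw [QuadraticMap.map_smul, smul_eq_mul, map_mul, hx, ← map_mul]
      congr 1
      linear_combination d * (r * x 2 + 1) * hr
    have scaled := planeDiscr_smul_add_smul_left q r 0 v w
    rw [zero_smul, add_zero] at scaled
    obtain ⟨v', hv', hv'w⟩ := exists_map_eq_and_isUnit_planeDiscr hrv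
      (scaled ▸ ((IsUnit.of_mul_eq_one _ hr).pow 2).mul hw)
    exact .inr ⟨v', w, hv', hv'w⟩
  · have hxy : IsUnit (x 0) ∨ IsUnit (x 1) := by
      simpa [Fin.exists_fin_succ, hx2] using hunit
    obtain ⟨w, hw⟩ := exists_isUnit_planeDiscr hef hxy
    rw [← residue_ne_zero_iff_isUnit, not_not] at hx2
    exact .inl (nonempty_isometry_binaryForm_zero_of_planeDiscr (by rw [hx]; simp [hx2]) hw)

theorem nonempty_isometry_binaryForm_zero_or {q : QuadraticForm R M} {e f : M} {c : R}
    (hc : ∀ t : R, IsUnit (t ^ 2 + t + c)) (hef : IsUnit (planeDiscr q e f)) :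
    Nonempty (binaryForm 0 →qᵢ q) ∨ Nonempty (binaryForm c →qᵢ q) := by
  rcases nonempty_isometry_binaryForm_zero_or_exists_map_eq hef 1 isUnit_one with
    hyperbolic | ⟨v, w, hv, hvw⟩
  · exact .inl hyperbolic
  · obtain ⟨d, hd, ⟨φ⟩⟩ := exists_nonempty_isometry_binaryForm hv hvw
    exact (nonempty_isometry_binaryForm_binaryForm hc hd).imp (fun ⟨ψ⟩ => ⟨φ.comp ψ⟩)
      fun ⟨ψ⟩ => ⟨φ.comp ψ⟩

theorem nonempty_isometry_binaryForm_zero_binaryForm_prod {c a : R} (hc : IsUnit (1 - 4 * c))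
    (ha : IsUnit a) :
    Nonempty (binaryForm 0 →qᵢ (binaryForm c).prod (a • QuadraticMap.sq)) := by
  rcases nonempty_isometry_binaryForm_zero_or_exists_map_eq (q := binaryForm c)
    (planeDiscr_binaryForm c ▸ hc) (-a) ha.neg with ⟨⟨φ⟩⟩ | ⟨v, w, hv, hvw⟩
  · exact ⟨(QuadraticMap.Isometry.inl _ _).comp φ⟩
  · obtain ⟨u, hu⟩ := exists_isUnit_polarBilin hvw
    refine nonempty_isometry_binaryForm_zero (v := (v, 1)) (w := (u, 0)) ?_ ?_
    · simp [hv]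
    · convert hu using 1
      simp [QuadraticMap.polar]

end FiniteResidueField

section Kernel

open Module

variable {R M : Type*} [CommRing R] [IsDomain R] [AddCommGroup M] [Module R M]

theorem exists_projection_ker [IsPrincipalIdealRing R] (f : Dual R M) :
    ∃ p : M →ₗ[R] LinearMap.ker f, ∀ x : LinearMap.ker f, p x = x := by
  obtain ⟨s, hs⟩ := Module.projective_lifting_property f.rangeRestrict LinearMap.id
    f.surjective_rangeRestrict
  have map_section (y : LinearMap.range f) : f (s y) = y :=
    congrArg Subtype.val (LinearMap.congr_fun hs y)
  refine ⟨LinearMap.codRestrict _ (LinearMap.id - s ∘ₗ f.rangeRestrict) fun x => ?_, fun x => ?_⟩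
  · simp [LinearMap.mem_ker, map_section]
  · have map_eq_zero : f.rangeRestrict x = 0 := Subtype.ext x.2
    ext
    simp [map_eq_zero]

theorem exists_forall_mem_ker_polarBilin_eq [IsPrincipalIdealRing R] {q : QuadraticForm R M}
    {f₀ : Dual R M} (h : ∀ f : Dual R M, ∃ (r : R) (x : M), f = r • f₀ + q.polarBilin x)
    (g : Dual R (LinearMap.ker f₀)) :
    ∃ x : M, ∀ y : LinearMap.ker f₀, q.polarBilin x y = g y := by
  obtain ⟨p, hp⟩ := exists_projection_ker f₀
  obtain ⟨r, x, hx⟩ := h (g ∘ₗ p)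
  refine ⟨x, fun y => ?_⟩
  have hxy := LinearMap.congr_fun hx y
  rwa [LinearMap.comp_apply, hp, LinearMap.add_apply, LinearMap.smul_apply,
    LinearMap.mem_ker.1 y.2, smul_zero, zero_add, eq_comm] at hxy

variable [Module.Finite R M]

theorem finrank_le_finrank_ker_add_one (f : Dual R M) :
    finrank R M ≤ finrank R (LinearMap.ker f) + 1 := by
  rw [← Submodule.finrank_quotient_add_finrank (LinearMap.ker f), f.quotKerEquivRange.finrank_eq,
    add_comm]
  gcongr
  exact (Submodule.finrank_le _).trans_eq (finrank_self R)

theorem finrank_eq_finrank_ker_add_one {f : Dual R M} (hf : Function.Surjective f) :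
    finrank R M = finrank R (LinearMap.ker f) + 1 := by
  rw [← Submodule.finrank_quotient_add_finrank (LinearMap.ker f),
    (f.quotKerEquivOfSurjective hf).finrank_eq, finrank_self, add_comm]

end Kernel

section Splitting

open IsLocalRing Module

variable {R M : Type*} [CommRing R] [IsDomain R] [IsPrincipalIdealRing R] [IsLocalRing R]
variable [AddCommGroup M] [Module R M] [Module.Free R M] [Module.Finite R M]

theorem isUnit_det_toMatrix_of_residue_eq {R M ι : Type*} [CommRing R] [IsLocalRing R]
    [AddCommGroup M] [Module R M] [Fintype ι] [DecidableEq ι] {B : LinearMap.BilinForm R M}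
    (b : Basis ι R M) (n : ι → M)
    (h : ∀ i j, residue R (B (n i) (b j)) = if j = i then 1 else 0) :
    IsUnit (LinearMap.BilinForm.toMatrix b B).det := by
  let X : Matrix ι ι R := Matrix.of fun i => b.repr (n i)
  have mul_apply (i j : ι) : (X * LinearMap.BilinForm.toMatrix b B) i j = B (n i) (b j) := by
    conv_rhs => rw [← b.sum_repr (n i)]
    simp only [map_sum, map_smul, LinearMap.sum_apply, LinearMap.smul_apply, smul_eq_mul,
      Matrix.mul_apply, X, Matrix.of_apply, LinearMap.BilinForm.toMatrix_apply]
  have mul_eq_one : (X * LinearMap.BilinForm.toMatrix b B).map (residue R) = 1 := by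
    ext i j
    simp only [Matrix.map_apply, mul_apply, h, Matrix.one_apply, eq_comm]
  refine isUnit_of_mul_isUnit_right (x := X.det) ((residue_ne_zero_iff_isUnit _).1 ?_)
  rw [← Matrix.det_mul, RingHom.map_det, RingHom.mapMatrix_apply, mul_eq_one, Matrix.det_one]
  exact one_ne_zero

theorem exists_isUnit_planeDiscr_of_forall_residue_eq_zero {q : QuadraticForm R M} {f₀ : Dual R M}
    (h : ∀ f : Dual R M, ∃ (r : R) (x : M), f = r • f₀ + q.polarBilin x) (hM : finrank R M = 3)
    {v : M} (hv : ∀ x, residue R (q.polarBilin v x) = 0) (hf₀v : IsUnit (f₀ v)) :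
    ∃ e f : M, IsUnit (planeDiscr q e f) := by
  -- `M = R v ⊕ ker f₀`, and `v` is orthogonal to `M` modulo the maximal ideal.
  obtain ⟨s, hs⟩ := hf₀v.exists_left_inv
  have f₀_surjective : Function.Surjective f₀ := fun r => ⟨(r * s) • v, by simp [mul_assoc, hs]⟩
  have finrank_ker := finrank_eq_finrank_ker_add_one f₀_surjective
  let b : Basis (Fin 2) R (LinearMap.ker f₀) := finBasisOfFinrankEq R _ (by omega)
  choose x hx using fun i => exists_forall_mem_ker_polarBilin_eq h (b.coord i)
  let n (i : Fin 2) : LinearMap.ker f₀ :=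
    ⟨x i - (f₀ (x i) * s) • v, by simp [LinearMap.mem_ker, mul_assoc, hs]⟩
  refine ⟨b 0, b 1, ?_⟩
  change IsUnit (planeDiscr (q.restrict (LinearMap.ker f₀)) (b 0) (b 1))
  rw [planeDiscr_eq_neg_det_toMatrix, IsUnit.neg_iff]
  refine isUnit_det_toMatrix_of_residue_eq b n fun i j => ?_
  change residue R (q.polarBilin (x i - (f₀ (x i) * s) • v) (b j)) = _
  rw [map_sub, map_smul, LinearMap.sub_apply, LinearMap.smul_apply, smul_eq_mul, hx, map_sub,
    map_mul, hv, mul_zero, sub_zero, b.coord_apply, b.repr_self, Finsupp.single_apply,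
    apply_ite (residue R), map_one, map_zero]

variable [Finite (ResidueField R)]

theorem HasCyclicDiscriminant.exists_isUnit_planeDiscr {q : QuadraticForm R M}
    (h : HasCyclicDiscriminant q) (hM : finrank R M = 3) :
    ∃ e f : M, IsUnit (planeDiscr q e f) := by
  obtain ⟨f₀, h⟩ := h
  let b := finBasisOfFinrankEq R M hM
  obtain ⟨a, ha, i, hai⟩ := exists_residue_map_sum_smul_eq_zero (by simp) q b
  set v := ∑ i, a i • b i
  by_cases! hv : ∃ w, residue R (q.polarBilin v w) ≠ 0
  · obtain ⟨w, hw⟩ := hv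
    refine ⟨v, w, ?_⟩
    rw [← residue_ne_zero_iff_isUnit, planeDiscr, discrim, map_sub, map_mul, map_mul, ha, map_pow]
    simpa using hw
  · refine exists_isUnit_planeDiscr_of_forall_residue_eq_zero h hM hv ?_
    obtain ⟨r, x, hx⟩ := h (b.coord i)
    have eval : a i = r * f₀ v + q.polarBilin v x := by
      rw [polarBilin_comm, ← b.repr_sum_self a]
      exact LinearMap.congr_fun hx v
    rw [← residue_ne_zero_iff_isUnit] at hai ⊢
    rw [eval, map_add, hv, add_zero, map_mul] at hai
    exact right_ne_zero_of_mul hai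

end Splitting

section Classification

open IsLocalRing Module

theorem exists_equivalent_smul_sq {R M : Type*} [CommRing R] [StrongRankCondition R]
    [AddCommGroup M] [Module R M] [Module.Free R M] (hM : finrank R M = 1)
    (q : QuadraticForm R M) : ∃ a : R, q.Equivalent (a • QuadraticMap.sq) := by
  have := Module.finite_of_finrank_eq_succ hM
  obtain ⟨φ⟩ := nonempty_linearEquiv_of_finrank_eq_one hM
  refine ⟨q (φ 1), ⟨{ toLinearEquiv := φ.symm, map_app' := fun x => ?_ }⟩⟩
  change q (φ 1) * (φ.symm x * φ.symm x) = q x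
  conv_rhs => rw [← φ.apply_symm_apply x, ← mul_one (φ.symm x), ← smul_eq_mul, map_smul,
    QuadraticMap.map_smul, smul_eq_mul, mul_comm]

variable {R M : Type*} [CommRing R] [IsDomain R] [IsPrincipalIdealRing R]
variable [AddCommGroup M] [Module R M] [Module.Free R M] [Module.Finite R M]

theorem exists_equivalent_binaryForm_prod {q : QuadraticForm R M} {ε : R}
    (hε : IsUnit (1 - 4 * ε)) (φ : binaryForm ε →qᵢ q) :
    ∃ N : Submodule R M, finrank R N + 2 = finrank R M ∧
      q.Equivalent ((binaryForm ε).prod (q.restrict N)) := by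
  obtain ⟨N, hN⟩ := (isUnimodular_binaryForm hε).exists_equivalent_prod φ
  refine ⟨N, ?_, hN.symm⟩
  obtain ⟨ψ⟩ := hN
  rw [← ψ.toLinearEquiv.finrank_eq, finrank_prod, finrank_prod, finrank_self, add_comm]

theorem exists_equivalent_binaryForm_prod_smul_sq {q : QuadraticForm R M} (hM : finrank R M = 3)
    {ε : R} (hε : IsUnit (1 - 4 * ε)) (φ : binaryForm ε →qᵢ q) :
    ∃ a : R, q.Equivalent ((binaryForm ε).prod (a • QuadraticMap.sq)) := by
  obtain ⟨N, hN, hq⟩ := exists_equivalent_binaryForm_prod hε φ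
  obtain ⟨a, ha⟩ := exists_equivalent_smul_sq (by omega) (q.restrict N)
  exact ⟨a, hq.trans (.prod (.refl _) ha)⟩

variable [HenselianLocalRing R] [Finite (ResidueField R)]

theorem HasCyclicDiscriminant.nonempty_isometry_binaryForm_zero {q : QuadraticForm R M}
    (h : HasCyclicDiscriminant q) (hM : 4 ≤ finrank R M) : Nonempty (binaryForm 0 →qᵢ q) := by
  obtain ⟨f₀, h⟩ := h
  let b := finBasis R (LinearMap.ker f₀)
  have card_ge : 3 ≤ Fintype.card (Fin (finrank R (LinearMap.ker f₀))) := by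
    have := finrank_le_finrank_ker_add_one f₀
    rw [Fintype.card_fin]
    omega
  obtain ⟨a, ha, i, hai⟩ := exists_residue_map_sum_smul_eq_zero card_ge
    (q.restrict (LinearMap.ker f₀)) b
  obtain ⟨x, hx⟩ := exists_forall_mem_ker_polarBilin_eq h (b.coord i)
  refine QuadraticLattice.nonempty_isometry_binaryForm_zero ha (w := x) ?_
  rw [polarBilin_comm, hx, b.coord_apply, b.repr_sum_self]
  exact hai

theorem HasCyclicDiscriminant.exists_equivalent_binaryForm_prod_smul_sq {q : QuadraticForm R M}
    (h : HasCyclicDiscriminant q) (hM : finrank R M = 3) {c : R}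
    (hc : ∀ t : R, IsUnit (t ^ 2 + t + c)) :
    ∃ ε a : R, (ε = 0 ∨ ε = c ∧ ¬ IsUnit a) ∧
      q.Equivalent ((binaryForm ε).prod (a • QuadraticMap.sq)) := by
  by_cases hyperbolic : Nonempty (binaryForm 0 →qᵢ q)
  · obtain ⟨φ⟩ := hyperbolic
    obtain ⟨a, ha⟩ :=
      QuadraticLattice.exists_equivalent_binaryForm_prod_smul_sq hM (by simp) φ
    exact ⟨0, a, .inl rfl, ha⟩
  · obtain ⟨e, f, hef⟩ := h.exists_isUnit_planeDiscr hM
    obtain ⟨φ⟩ := (nonempty_isometry_binaryForm_zero_or hc hef).resolve_left hyperbolic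
    obtain ⟨a, ha⟩ := QuadraticLattice.exists_equivalent_binaryForm_prod_smul_sq hM
      (isUnit_one_sub_four_mul hc) φ
    refine ⟨c, a, .inr ⟨rfl, fun a_isUnit => hyperbolic ?_⟩, ha⟩
    obtain ⟨ψ⟩ := nonempty_isometry_binaryForm_zero_binaryForm_prod
      (isUnit_one_sub_four_mul hc) a_isUnit
    obtain ⟨χ⟩ := ha.symm
    exact ⟨χ.toIsometry.comp ψ⟩

theorem HasCyclicDiscriminant.exists_equivalent_evenForm_prod_smul_sq {M : Type*} [AddCommGroup M]
    [Module R M] [Module.Free R M] [Module.Finite R M] {q : QuadraticForm R M}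
    (h : HasCyclicDiscriminant q) {m : ℕ} (hM : finrank R M = 2 * m + 3) {c : R}
    (hc : ∀ t : R, IsUnit (t ^ 2 + t + c)) :
    ∃ ε a : R, (ε = 0 ∨ ε = c ∧ ¬ IsUnit a) ∧
      q.Equivalent ((evenForm m ε).prod (a • QuadraticMap.sq)) := by
  induction m generalizing M with
  | zero =>
    obtain ⟨ε, a, hε, ha⟩ := h.exists_equivalent_binaryForm_prod_smul_sq hM hc
    exact ⟨ε, a, hε, ha.trans (.prod (evenForm_zero_equivalent ε).symm (.refl _))⟩
  | succ m ih =>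
    obtain ⟨φ⟩ := h.nonempty_isometry_binaryForm_zero (by omega)
    obtain ⟨N, hN, hq⟩ := exists_equivalent_binaryForm_prod (by simp) φ
    obtain ⟨ε, a, hε, ha⟩ := ih (h.of_equivalent hq).of_prod (by omega)
    refine ⟨ε, a, hε, hq.trans ?_⟩
    exact ((QuadraticMap.Equivalent.prod (.refl _) ha).trans (equivalent_prod_assoc _ _ _)).trans
      (.prod (evenForm_succ_equivalent m ε) (.refl _))

theorem HasCyclicDiscriminant.exists_equivalent_modelForm {q : QuadraticForm R M}
    (h : HasCyclicDiscriminant q) (h2 : (2 : R) ≠ 0) {m : ℕ} (hM : finrank R M = 2 * m + 3)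
    {N : R} (hN : HasGramDet q ((-1) ^ (m + 1) * (2 * N))) {c : R}
    (hc : ∀ t : R, IsUnit (t ^ 2 + t + c)) :
    ∃ ε : R, (ε = 0 ∨ ε = c ∧ ¬ IsUnit N) ∧ q.Equivalent (modelForm m ε N) := by
  obtain ⟨ε, a, hε, hq⟩ := h.exists_equivalent_evenForm_prod_smul_sq hM hc
  have gram := (hasGramDet_evenForm m ε).prod (hasGramDet_smul_sq a)
  obtain ⟨u, hu, huN⟩ := (gram.of_equivalent hq.symm).exists_eq_sq_mul hN
  have N_eq : N = (1 - 4 * ε) * u ^ 2 * a := by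
    refine mul_left_cancel₀ (mul_ne_zero (pow_ne_zero (m + 1) (neg_ne_zero.2 one_ne_zero)) h2) ?_
    linear_combination huN
  have isUnit_ε := isUnit_one_sub_four_mul_of_eq_zero_or_eq hc (hε.imp_right And.left)
  have not_isUnit_N : ¬ IsUnit a → ¬ IsUnit N := mt fun hNu => by
    rw [N_eq] at hNu
    exact isUnit_of_mul_isUnit_right hNu
  have coeff : (1 - 4 * ε) * N = a * ((1 - 4 * ε) * u) ^ 2 := by rw [N_eq]; ring
  refine ⟨ε, hε.imp_right (And.imp_right not_isUnit_N), hq.trans (.prod (.refl _) ?_)⟩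
  rw [coeff]
  exact equivalent_smul_sq_mul_sq a (isUnit_ε.mul hu)

end Classification

section IntegralForm

open Module

variable {R k V W : Type*} [CommRing R] [Field k] [Algebra R k] [IsFractionRing R k]
  [AddCommGroup V] [Module R V] [Module k V] [IsScalarTower R k V]
  [AddCommGroup W] [Module R W] [Module k W] [IsScalarTower R k W]
  {Q : QuadraticForm k V} {L : Submodule R V} {P : QuadraticForm k W} {M : Submodule R W}

/-- The restriction of `Q` to an integral lattice `L`, as a quadratic form with values in `R`. -/
noncomputable def integralForm (Q : QuadraticForm k V) {L : Submodule R V}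
    (h : IsIntegral Q L) : QuadraticForm R L :=
  let QL : QuadraticMap R L k := (Q.restrictScalars (S := R)).comp L.subtype
  have spec (x : L) : algebraMap R k (h x x.2).choose = QL x := (h x x.2).choose_spec
  QuadraticMap.ofPolar (fun x => (h x x.2).choose)
    (fun a x => IsFractionRing.injective R k <| by
      rw [spec, QL.map_smul, smul_eq_mul, map_mul, map_mul, spec, Algebra.smul_def, map_mul])
    (fun x x' y => IsFractionRing.injective R k <| by
      simpa only [QuadraticMap.polar, map_sub, map_add, spec] using QL.polar_add_left x x' y)
    (fun a x y => IsFractionRing.injective R k <| by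
      simpa only [QuadraticMap.polar, map_sub, map_mul, spec, smul_eq_mul, Algebra.smul_def]
        using QL.polar_smul_left a x y)

theorem algebraMap_integralForm (h : IsIntegral Q L) (x : L) :
    algebraMap R k (integralForm Q h x) = Q x :=
  (h x x.2).choose_spec

theorem algebraMap_polarBilin_integralForm (h : IsIntegral Q L) (x y : L) :
    algebraMap R k ((integralForm Q h).polarBilin x y) = Q.polarBilin (x : V) y := by
  simp only [QuadraticMap.polarBilin_apply_apply, QuadraticMap.polar, map_sub,
    algebraMap_integralForm, Submodule.coe_add]

theorem algebraMap_det_toMatrix_integralForm {ι : Type*} [Fintype ι] [DecidableEq ι]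
    (h : IsIntegral Q L) (b : Basis ι R L) :
    algebraMap R k (LinearMap.BilinForm.toMatrix b (integralForm Q h).polarBilin).det =
      (Matrix.of fun i j => Q.polarBilin (b i : V) (b j : V)).det := by
  rw [RingHom.map_det]
  congr 1
  ext i j
  simp only [RingHom.mapMatrix_apply, Matrix.map_apply, LinearMap.BilinForm.toMatrix_apply,
    algebraMap_polarBilin_integralForm, Matrix.of_apply]

theorem hasDet_algebraMap_iff [Nontrivial R] (h : IsIntegral Q L) {d : R} :
    HasDet Q L (algebraMap R k d) ↔
      HasGramDet (integralForm Q h) ((-1) ^ (finrank R L / 2) * d) := by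
  refine exists_congr fun m => exists_congr fun b => ?_
  have sign_sq : ((-1) ^ (m / 2) : R) * (-1) ^ (m / 2) = 1 := by simp [← mul_pow]
  rw [signedDet, ← algebraMap_det_toMatrix_integralForm h, finrank_eq_card_basis b,
    Fintype.card_fin, show ((-1) ^ (m / 2) : k) = algebraMap R k ((-1) ^ (m / 2)) by simp,
    ← map_mul, (IsFractionRing.injective R k).eq_iff]
  constructor <;> intro det_eq
  · rw [← det_eq, ← mul_assoc, sign_sq, one_mul]
  · rw [det_eq, ← mul_assoc, sign_sq, one_mul]

theorem HasGramDet.polarBilin_nondegenerate [IsDomain R] [L.IsLattice k] {h : IsIntegral Q L}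
    {d : R} (hd : HasGramDet (integralForm Q h) d) (hd0 : d ≠ 0) : Q.polarBilin.Nondegenerate := by
  obtain ⟨m, b, rfl⟩ := hd
  refine LinearMap.BilinForm.nondegenerate_of_det_ne_zero _ (b.extendOfIsLattice k) ?_
  have gram : LinearMap.BilinForm.toMatrix (b.extendOfIsLattice k) Q.polarBilin =
      Matrix.of fun i j => Q.polarBilin (b i : V) (b j : V) := by
    ext i j
    simp only [LinearMap.BilinForm.toMatrix_apply, Basis.extendOfIsLattice_apply, Matrix.of_apply]
  rw [gram, ← algebraMap_det_toMatrix_integralForm h]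
  exact (map_ne_zero_iff _ (IsFractionRing.injective R k)).2 hd0

theorem exists_smul_mem_of_isLattice (L : Submodule R V) [L.IsLattice k] (x : V) :
    ∃ r : R, algebraMap R k r ≠ 0 ∧ r • x ∈ L := by
  have hx : x ∈ Submodule.span k (L : Set V) :=
    Submodule.IsLattice.span_eq_top (A := k) (M := L) ▸ Submodule.mem_top
  induction hx using Submodule.span_induction with
  | mem x hx => exact ⟨1, by simp, by simpa⟩
  | zero => exact ⟨1, by simp, by simp⟩
  | add x y _ _ hx hy =>
    obtain ⟨r, hr, hrx⟩ := hx
    obtain ⟨s, hs, hsy⟩ := hy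
    refine ⟨r * s, by simp [hr, hs], ?_⟩
    rw [smul_add, mul_smul, mul_smul, smul_comm r s x]
    exact L.add_mem (L.smul_mem s hrx) (L.smul_mem r hsy)
  | smul a x _ hx =>
    obtain ⟨r, hr, hrx⟩ := hx
    obtain ⟨⟨n, d⟩, had⟩ := IsLocalization.surj (nonZeroDivisors R) a
    refine ⟨d * r, by simpa [hr] using IsLocalization.map_units k d, ?_⟩
    have clear_denominator : (d * r : R) • a • x = n • r • x := by
      rw [← algebraMap_smul k, ← algebraMap_smul k n, ← algebraMap_smul k r x, smul_smul,
        smul_smul, ← had, map_mul]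
      congr 1
      ring
    rw [clear_denominator]
    exact L.smul_mem n hrx

theorem map_eq_of_forall_mem [L.IsLattice k] {Q' : QuadraticForm k V} (h : ∀ x ∈ L, Q' x = Q x)
    (x : V) : Q' x = Q x := by
  obtain ⟨r, hr, hrx⟩ := exists_smul_mem_of_isLattice L x
  have := h _ hrx
  rw [← algebraMap_smul k r x, QuadraticMap.map_smul, QuadraticMap.map_smul] at this
  exact mul_left_cancel₀ (mul_ne_zero hr hr) this

theorem exists_linearEquiv_forall_coe_eq [IsDomain R] [IsPrincipalIdealRing R] [L.IsLattice k]
    [M.IsLattice k] (φ : L ≃ₗ[R] M) : ∃ σ : V ≃ₗ[k] W, ∀ x : L, σ x = φ x := by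
  let b := finBasis R L
  let bV : Basis _ k V := b.extendOfIsLattice k
  let bW : Basis _ k W := (b.map φ).extendOfIsLattice k
  let σ : V ≃ₗ[k] W := bV.equiv bW (Equiv.refl _)
  refine ⟨σ, LinearMap.congr_fun (f := σ.toLinearMap.restrictScalars R ∘ₗ L.subtype)
    (g := M.subtype ∘ₗ φ.toLinearMap) (b.ext fun i => ?_)⟩
  have σ_basis : σ (b i) = φ (b i) := by
    simpa only [bV, bW, Basis.extendOfIsLattice_apply, Equiv.refl_apply, Basis.map_apply]
      using bV.equiv_apply i bW (Equiv.refl _)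
  exact σ_basis

theorem isometric_of_equivalent_integralForm [IsDomain R] [IsPrincipalIdealRing R] [L.IsLattice k]
    [M.IsLattice k] {hQ : IsIntegral Q L} {hP : IsIntegral P M}
    (h : (integralForm Q hQ).Equivalent (integralForm P hP)) : Isometric Q L P M := by
  obtain ⟨φ⟩ := h
  obtain ⟨σ, hσ⟩ := exists_linearEquiv_forall_coe_eq (k := k) φ.toLinearEquiv
  have isometry_on_lattice (x : V) (hx : x ∈ L) : P.comp σ.toLinearMap x = Q x := by
    rw [QuadraticMap.comp_apply, LinearEquiv.coe_coe, hσ ⟨x, hx⟩, ← algebraMap_integralForm hP,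
      ← algebraMap_integralForm hQ ⟨x, hx⟩]
    exact congrArg _ (φ.map_app _)
  refine ⟨{ toLinearEquiv := σ, map_app' := map_eq_of_forall_mem isometry_on_lattice },
    fun x => ⟨fun hx => ?_, fun hx => ?_⟩⟩
  · have : σ (φ.toLinearEquiv.symm ⟨σ x, hx⟩ : L) = σ x := by
      rw [hσ, LinearEquiv.apply_symm_apply]
    exact σ.injective this ▸ Subtype.property _
  · exact (hσ ⟨x, hx⟩).symm ▸ Subtype.property _

open TensorProduct in
theorem exists_isLattice_integralForm_equivalent [IsDomain R] [Module.Finite k V] {U : Type*}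
    [AddCommGroup U] [Module R U] [Module.Free R U] [Module.Finite R U]
    (hU : finrank R U = finrank k V) (q : QuadraticForm R U) :
    ∃ (Q : QuadraticForm k V) (L : Submodule R V) (h : IsIntegral Q L),
      L.IsLattice k ∧ (integralForm Q h).Equivalent q := by
  obtain ⟨B, rfl⟩ := LinearMap.BilinMap.toQuadraticMap_surjective q
  let σ : k ⊗[R] U ≃ₗ[k] V := LinearEquiv.ofFinrankEq _ _ (Module.finrank_baseChange.trans hU)
  let ι : U →ₗ[R] V := σ.toLinearMap.restrictScalars R ∘ₗ TensorProduct.mk R k U 1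
  have ι_injective : Function.Injective ι :=
    σ.injective.comp (Module.Flat.tensorProduct_mk_injective R U k)
  let Q : QuadraticForm k V :=
    (LinearMap.BilinMap.toQuadraticMap (LinearMap.BilinForm.baseChange k B)).comp σ.symm.toLinearMap
  have map_ι (x : U) : Q (ι x) = algebraMap R k (B x x) := by
    simp [Q, ι, Algebra.smul_def]
  have integral : IsIntegral Q (LinearMap.range ι) := by
    rintro _ ⟨x, rfl⟩
    exact ⟨_, (map_ι x).symm⟩
  refine ⟨Q, LinearMap.range ι, integral, ⟨Module.Finite.iff_fg.1 (Module.Finite.range ι), ?_⟩, ?_⟩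
  · have span_range_mk : Submodule.span k (Set.range (TensorProduct.mk R k U 1)) = ⊤ := by
      rw [← Submodule.baseChange_top (R := R) (M := U), Submodule.baseChange_eq_span,
        Submodule.map_top, LinearMap.coe_range]
    rw [LinearMap.coe_range, LinearMap.coe_comp, Set.range_comp]
    exact (Submodule.span_image σ.toLinearMap).trans (by rw [span_range_mk]; simp)
  · let e := LinearEquiv.ofInjective ι ι_injective
    let φ : B.toQuadraticMap.IsometryEquiv (integralForm Q integral) :=
      { toLinearEquiv := e
        map_app' := fun x => IsFractionRing.injective R k <|
          (algebraMap_integralForm integral (e x)).trans (map_ι x) }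
    exact ⟨φ.symm⟩

end IntegralForm

section Dual

open Module

variable {R k V : Type*} [CommRing R] [Field k] [Algebra R k]
  [AddCommGroup V] [Module R V] [Module k V] [IsScalarTower R k V]
  {Q : QuadraticForm k V} {L : Submodule R V}

theorem isPrincipal_top_quotient_iff {A : Type*} [AddCommGroup A] [Module R A]
    {B : Submodule R A} :
    (⊤ : Submodule R (A ⧸ B)).IsPrincipal ↔ ∃ g : A, ∀ x : A, ∃ r : R, x - r • g ∈ B := by
  rw [Submodule.isPrincipal_iff, B.mkQ_surjective.exists]
  refine exists_congr fun g => ?_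
  rw [eq_comm, Submodule.eq_top_iff', B.mkQ_surjective.forall]
  refine forall_congr' fun x => ?_
  rw [Submodule.mem_span_singleton]
  exact exists_congr fun r => eq_comm.trans (Submodule.Quotient.eq B)

theorem mem_dual_iff {x : V} :
    x ∈ dual Q L ↔ ∀ y ∈ L, ∃ r : R, algebraMap R k r = Q.polarBilin x y := by
  simp only [dual, LinearMap.BilinForm.mem_dualSubmodule, Submodule.mem_one]

variable [IsFractionRing R k]

theorem mem_dual_of_mem (h : IsIntegral Q L) {x : V} (hx : x ∈ L) : x ∈ dual Q L :=
  mem_dual_iff.2 fun y hy => ⟨_, algebraMap_polarBilin_integralForm h ⟨x, hx⟩ ⟨y, hy⟩⟩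

theorem exists_mem_dual_forall_polarBilin_eq [IsDomain R] [IsPrincipalIdealRing R] [L.IsLattice k]
    (hQ : Q.polarBilin.Nondegenerate) (f : Dual R L) :
    ∃ x ∈ dual Q L, ∀ y : L, Q.polarBilin x y = algebraMap R k (f y) := by
  let b := finBasis R L
  let bV : Basis _ k V := b.extendOfIsLattice k
  have : FiniteDimensional k V := bV.finiteDimensional_of_finite
  let F : V →ₗ[k] k := bV.constr k fun i => algebraMap R k (f (b i))
  have F_basis (i) : F (b i) = algebraMap R k (f (b i)) := by
    simpa only [bV, Basis.extendOfIsLattice_apply]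
      using bV.constr_basis k (fun i => algebraMap R k (f (b i))) i
  have F_eq : F.restrictScalars R ∘ₗ L.subtype = Algebra.linearMap R k ∘ₗ f := b.ext F_basis
  obtain ⟨x, hx⟩ := (LinearMap.BilinForm.toDual Q.polarBilin hQ).surjective F
  have pairing (y : L) : Q.polarBilin x y = algebraMap R k (f y) := by
    rw [← LinearMap.BilinForm.toDual_def hQ, hx]
    exact LinearMap.congr_fun F_eq y
  exact ⟨x, mem_dual_iff.2 fun y hy => ⟨f ⟨y, hy⟩, (pairing ⟨y, hy⟩).symm⟩, pairing⟩

theorem dualSubmoduleToDual_bijective [IsDomain R] [IsPrincipalIdealRing R] [L.IsLattice k]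
    (hQ : Q.polarBilin.Nondegenerate) :
    Function.Bijective (LinearMap.BilinForm.dualSubmoduleToDual Q.polarBilin L) := by
  refine ⟨LinearMap.BilinForm.dualSubmoduleToDual_injective _ hQ L Submodule.IsLattice.span_eq_top,
    fun f => ?_⟩
  obtain ⟨x, hx, hxf⟩ := exists_mem_dual_forall_polarBilin_eq hQ f
  refine ⟨⟨x, hx⟩, LinearMap.ext fun y => IsFractionRing.injective R k ?_⟩
  exact (LinearMap.BilinForm.dualSubmoduleParing_spec _ _ _).trans (hxf y)

theorem dualSubmoduleToDual_apply_of_mem [IsDomain R] (h : IsIntegral Q L) (x : L) :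
    LinearMap.BilinForm.dualSubmoduleToDual Q.polarBilin L ⟨x, mem_dual_of_mem h x.2⟩ =
      (integralForm Q h).polarBilin x :=
  LinearMap.ext fun y => IsFractionRing.injective R k <|
    (LinearMap.BilinForm.dualSubmoduleParing_spec _ _ _).trans
      (algebraMap_polarBilin_integralForm h x y).symm

theorem hasCyclicDiscriminant_integralForm_iff [IsDomain R] [IsPrincipalIdealRing R]
    [L.IsLattice k] (hQ : Q.polarBilin.Nondegenerate) (h : IsIntegral Q L) :
    HasCyclicDiscriminant (integralForm Q h) ↔
      (⊤ : Submodule R (dual Q L ⧸ L.submoduleOf (dual Q L))).IsPrincipal := by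
  let δ : dual Q L ≃ₗ[R] Dual R L := .ofBijective _ (dualSubmoduleToDual_bijective hQ)
  have δ_coe (y : L) : δ ⟨y, mem_dual_of_mem h y.2⟩ = (integralForm Q h).polarBilin y :=
    dualSubmoduleToDual_apply_of_mem h y
  have mem_iff (x : dual Q L) :
      x ∈ L.submoduleOf (dual Q L) ↔ ∃ y : L, δ x = (integralForm Q h).polarBilin y := by
    refine ⟨fun hx => ⟨⟨x, hx⟩, δ_coe ⟨x, hx⟩⟩, fun ⟨y, hy⟩ => ?_⟩
    rw [δ.injective (hy.trans (δ_coe y).symm)]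
    exact y.2
  simp only [isPrincipal_top_quotient_iff, HasCyclicDiscriminant, δ.surjective.exists,
    δ.surjective.forall, mem_iff, map_sub, map_smul, sub_eq_iff_eq_add']

end Dual

section Eichler

variable {R k V U : Type*} [CommRing R] [Field k] [Algebra R k]
  [AddCommGroup V] [Module R V] [Module k V] [IsScalarTower R k V]
  [AddCommGroup U] [Module R U]
  {Q : QuadraticForm k V} {L : Submodule R V}

theorem eq_of_forall_mem_polarBilin_eq [L.IsLattice k] (hQ : Q.polarBilin.Nondegenerate) {x y : V}
    (h : ∀ z ∈ L, Q.polarBilin x z = Q.polarBilin y z) : x = y := by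
  refine LinearMap.ker_eq_bot.1 (LinearMap.BilinForm.Nondegenerate.ker_eq_bot hQ) ?_
  exact LinearMap.ext_on Submodule.IsLattice.span_eq_top h

variable [IsFractionRing R k]

theorem polarBilin_add_div_smul (h : IsIntegral Q L) {p : QuadraticForm R U} {a : R}
    (ha : algebraMap R k (2 * a) ≠ 0)
    (φ : (p.prod (a • QuadraticMap.sq)).IsometryEquiv (integralForm Q h)) (u : U) (t : R)
    (z : U × R) :
    Q.polarBilin (φ (u, 0) + (algebraMap R k t / algebraMap R k (2 * a)) • (φ (0, 1) : V)) (φ z) =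
      algebraMap R k (p.polarBilin u z.1 + t * z.2) := by
  have polarBilin_map (z' : U × R) : Q.polarBilin (φ z' : V) (φ z) =
      algebraMap R k (p.polarBilin z'.1 z.1 + 2 * a * z'.2 * z.2) := by
    rw [← algebraMap_polarBilin_integralForm h, ← polarBilin_prod_smul_sq]
    exact congrArg _ (polarBilin_map_map φ.toIsometry z' z)
  rw [map_add, map_smul, LinearMap.add_apply, LinearMap.smul_apply, polarBilin_map,
    polarBilin_map, map_zero, LinearMap.zero_apply, mul_zero, zero_mul, add_zero, zero_add,
    mul_one, map_mul _ (2 * a), smul_eq_mul, ← mul_assoc, div_mul_cancel₀ _ ha, ← map_mul,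
    ← map_add]

theorem mem_dual_iff_of_isometryEquiv [IsDomain R] [L.IsLattice k]
    (hQ : Q.polarBilin.Nondegenerate) (h : IsIntegral Q L) {p : QuadraticForm R U}
    (hp : IsUnimodular p) {a : R} (ha : algebraMap R k (2 * a) ≠ 0)
    (φ : (p.prod (a • QuadraticMap.sq)).IsometryEquiv (integralForm Q h)) {x : V} :
    x ∈ dual Q L ↔ ∃ (u : U) (t : R),
      x = φ (u, 0) + (algebraMap R k t / algebraMap R k (2 * a)) • (φ (0, 1) : V) := by
  have exists_eq_map (y : V) (hy : y ∈ L) : ∃ z, (φ z : V) = y :=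
    (φ.toLinearEquiv.surjective ⟨y, hy⟩).imp fun _ hz => congrArg Subtype.val hz
  constructor
  · intro hx
    let f : U × R →ₗ[R] R :=
      LinearMap.BilinForm.dualSubmoduleToDual Q.polarBilin L ⟨x, hx⟩ ∘ₗ φ.toLinearEquiv.toLinearMap
    obtain ⟨u, hu⟩ := hp.2 (f ∘ₗ LinearMap.inl R U R)
    refine ⟨u, f (0, 1), eq_of_forall_mem_polarBilin_eq (L := L) hQ fun y hy => ?_⟩
    obtain ⟨z, rfl⟩ := exists_eq_map y hy
    have hfz : f z = p.polarBilin u z.1 + f (0, 1) * z.2 := by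
      rw [apply_eq_apply_add_mul_apply, hu, mul_comm]
      rfl
    rw [polarBilin_add_div_smul h ha, ← hfz]
    exact (LinearMap.BilinForm.dualSubmoduleParing_spec Q.polarBilin ⟨x, hx⟩ (φ z)).symm
  · rintro ⟨u, t, rfl⟩
    refine mem_dual_iff.2 fun y hy => ?_
    obtain ⟨z, rfl⟩ := exists_eq_map y hy
    exact ⟨_, (polarBilin_add_div_smul h ha φ u t z).symm⟩

theorem algebraMap_mul_map_add_div_smul (h : IsIntegral Q L) {p : QuadraticForm R U} {a : R}
    (ha : algebraMap R k (2 * a) ≠ 0)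
    (φ : (p.prod (a • QuadraticMap.sq)).IsometryEquiv (integralForm Q h)) (u : U) (t : R) :
    algebraMap R k (4 * a) *
        Q (φ (u, 0) + (algebraMap R k t / algebraMap R k (2 * a)) • (φ (0, 1) : V)) =
      algebraMap R k (4 * a * p u + t ^ 2) := by
  have map_map (z : U × R) : Q (φ z : V) = algebraMap R k (p z.1 + a * z.2 ^ 2) := by
    rw [← algebraMap_integralForm h, sq]
    exact congrArg _ (φ.map_app z)
  have orthogonal : Q.polarBilin (φ (u, 0) : V) (φ (0, 1)) = 0 := by
    simpa using polarBilin_add_div_smul h ha φ u 0 (0, 1)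
  have := map_smul_add_smul Q 1 (algebraMap R k t / algebraMap R k (2 * a)) (φ (u, 0)) (φ (0, 1))
  rw [one_smul] at this
  rw [this, orthogonal, map_map, map_map]
  simp only [map_mul, map_ofNat] at ha
  have two_ne_zero := left_ne_zero_of_mul ha
  have a_ne_zero := right_ne_zero_of_mul ha
  simp only [map_mul, map_add, map_pow, map_ofNat, map_zero, map_one]
  field_simp
  ring

theorem eichlerInvariant_eq_one_iff [IsDomain R] [L.IsLattice k]
    (hQ : Q.polarBilin.Nondegenerate) (h : IsIntegral Q L) {p : QuadraticForm R U}
    (hp : IsUnimodular p) {δ N : R} (hδN : algebraMap R k (2 * (δ * N)) ≠ 0)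
    (φ : (p.prod ((δ * N) • QuadraticMap.sq)).IsometryEquiv (integralForm Q h)) :
    eichlerInvariant Q L N = 1 ↔ ∃ (u : U) (t : R), 4 * (δ * N) * p u + t ^ 2 = δ := by
  have δ_ne_zero : algebraMap R k δ ≠ 0 := by
    rw [map_mul, map_mul] at hδN
    exact left_ne_zero_of_mul (right_ne_zero_of_mul hδN)
  have clear_δ (x : V) :
      4 * algebraMap R k N * Q x = 1 ↔ algebraMap R k (4 * (δ * N)) * Q x = algebraMap R k δ := by
    rw [← mul_right_inj' δ_ne_zero, mul_one, map_mul, map_mul, map_ofNat]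
    ring_nf
  have eq_one_iff : eichlerInvariant Q L N = 1 ↔
      ∃ x ∈ dual Q L, 4 * algebraMap R k N * Q x = 1 := by
    unfold eichlerInvariant
    split_ifs with hx <;> simp [hx]
  simp only [eq_one_iff, clear_δ, mem_dual_iff_of_isometryEquiv hQ h hp hδN φ]
  constructor
  · rintro ⟨_, ⟨u, t, rfl⟩, hut⟩
    rw [algebraMap_mul_map_add_div_smul h hδN] at hut
    exact ⟨u, t, IsFractionRing.injective R k hut⟩
  · rintro ⟨u, t, hut⟩
    refine ⟨_, ⟨u, t, rfl⟩, ?_⟩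
    rw [algebraMap_mul_map_add_div_smul h hδN, hut]

end Eichler

section ModelForm

variable {R k V : Type*} [CommRing R] [IsDomain R] [Field k] [Algebra R k] [IsFractionRing R k]
  [AddCommGroup V] [Module R V] [Module k V] [IsScalarTower R k V]
  {Q : QuadraticForm k V} {L : Submodule R V}

theorem exists_sq_add_self_add_eq_zero [IsIntegrallyClosed R] (h2 : (2 : R) ≠ 0) {t d : R}
    (h : t ^ 2 = 1 - 4 * d) : ∃ s, s ^ 2 + s + d = 0 := by
  have two_ne_zero : (2 : FractionRing R) ≠ 0 := by
    rw [← map_ofNat (algebraMap R (FractionRing R))]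
    exact (map_ne_zero_iff _ (IsFractionRing.injective R (FractionRing R))).2 h2
  have hK := congrArg (algebraMap R (FractionRing R)) h
  simp only [map_pow, map_sub, map_mul, map_one, map_ofNat] at hK
  have root : ((algebraMap R (FractionRing R) t - 1) / 2) ^ 2 +
      (algebraMap R (FractionRing R) t - 1) / 2 + algebraMap R (FractionRing R) d = 0 := by
    field_simp
    linear_combination hK
  obtain ⟨s, hs⟩ : ∃ s, algebraMap R (FractionRing R) s =
      (algebraMap R (FractionRing R) t - 1) / 2 := by
    rw [← IsIntegrallyClosed.isIntegral_iff]
    refine ⟨Polynomial.X ^ 2 + Polynomial.X + Polynomial.C d, by monicity!, ?_⟩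
    simpa using root
  refine ⟨s, IsFractionRing.injective R (FractionRing R) ?_⟩
  simpa [hs] using root

theorem eichlerInvariant_eq_one_iff_of_equivalent_modelForm [IsIntegrallyClosed R] [L.IsLattice k]
    (hQ : Q.polarBilin.Nondegenerate) (h : IsIntegral Q L) (h2 : (2 : R) ≠ 0) {m : ℕ} {ε c N : R}
    (hN : N ≠ 0) (hc : ∀ t : R, IsUnit (t ^ 2 + t + c)) (hε : ε = 0 ∨ ε = c ∧ ¬ IsUnit N)
    (hq : (modelForm m ε N).Equivalent (integralForm Q h)) :
    eichlerInvariant Q L N = 1 ↔ ε = 0 := by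
  have hδ := isUnit_one_sub_four_mul_of_eq_zero_or_eq hc (hε.imp_right And.left)
  obtain ⟨φ⟩ := hq
  rw [eichlerInvariant_eq_one_iff hQ h (isUnimodular_evenForm m hδ) ?_ φ]
  · rcases hε with rfl | ⟨rfl, hN'⟩
    · exact iff_of_true ⟨0, 1, by simp⟩ rfl
    · refine iff_of_false (fun ⟨x, t, hxt⟩ => hN' ?_) fun hε0 => ?_
      · obtain ⟨s, hs⟩ := exists_sq_add_self_add_eq_zero h2
          (show t ^ 2 = 1 - 4 * (ε + (1 - 4 * ε) * N * evenForm m ε x) by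
            linear_combination hxt)
        have factor : s ^ 2 + s + ε = N * (-(1 - 4 * ε) * evenForm m ε x) := by
          linear_combination hs
        exact isUnit_of_mul_isUnit_left (factor ▸ hc s)
      · exact not_isUnit_zero (M₀ := R) (by simpa [hε0] using hc 0)
  · exact (map_ne_zero_iff _ (IsFractionRing.injective R k)).2
      (mul_ne_zero h2 (mul_ne_zero hδ.ne_zero hN))

end ModelForm

section Classification

open Module IsLocalRing

variable {R k V : Type*} [CommRing R] [IsDomain R] [IsPrincipalIdealRing R]
  [Field k] [Algebra R k] [IsFractionRing R k]
  [AddCommGroup V] [Module R V] [Module k V] [IsScalarTower R k V]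
  {Q : QuadraticForm k V} {L : Submodule R V} {m : ℕ} {N c : R} {e : ℤˣ}

theorem finrank_isLattice (L : Submodule R V) [L.IsLattice k] : finrank R L = finrank k V :=
  congrArg Cardinal.toNat (Submodule.IsLattice.rank' k L)

theorem finrank_modelForm_module (R : Type*) [CommRing R] [StrongRankCondition R] (m : ℕ) :
    finrank R (((Fin m → R × R) × R × R) × R) = 2 * m + 3 := by
  simp only [finrank_prod, finrank_pi_fintype, finrank_self, Finset.sum_const, Finset.card_univ,
    Fintype.card_fin, smul_eq_mul]
  ring

theorem hasDet_two_mul_algebraMap_iff [L.IsLattice k] (h : IsIntegral Q L)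
    (hV : finrank k V = 2 * m + 3) :
    HasDet Q L (2 * algebraMap R k N) ↔
      HasGramDet (integralForm Q h) ((-1) ^ (m + 1) * (2 * N)) := by
  rw [← map_ofNat (algebraMap R k) 2, ← map_mul, hasDet_algebraMap_iff h,
    finrank_isLattice (k := k) L, hV, show (2 * m + 3) / 2 = m + 1 by omega]

theorem IsSpecialOfType.equivalent_modelForm [HenselianLocalRing R] [Finite (ResidueField R)]
    (h : IsSpecialOfType Q L (2 * m + 3) N e) (h2 : (2 : R) ≠ 0) (hN : N ≠ 0)
    (hc : ∀ t : R, IsUnit (t ^ 2 + t + c)) :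
    (integralForm Q h.1.integral).Equivalent (modelForm m (if e = 1 then 0 else c) N) := by
  obtain ⟨⟨regular, isLattice, integral, -, cyclic⟩, rank, det, rfl⟩ := h
  obtain ⟨ε, hε, hq⟩ :=
    ((hasCyclicDiscriminant_integralForm_iff regular integral).2 cyclic).exists_equivalent_modelForm
      h2 ((finrank_isLattice L).trans rank) ((hasDet_two_mul_algebraMap_iff integral rank).1 det) hc
  have eichler :=
    eichlerInvariant_eq_one_iff_of_equivalent_modelForm regular integral h2 hN hc hε hq.symm
  have ε_eq : ε = if eichlerInvariant Q L N = 1 then 0 else c := by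
    split_ifs with he
    · exact eichler.1 he
    · exact (hε.resolve_left (mt eichler.2 he)).1
  exact ε_eq ▸ hq

theorem isSpecialOfType_of_equivalent_modelForm [L.IsLattice k] {h : IsIntegral Q L}
    (hq : (integralForm Q h).Equivalent (modelForm m (if e = 1 then 0 else c) N))
    (h2 : (2 : R) ≠ 0) (hN : N ≠ 0) (hc : ∀ t : R, IsUnit (t ^ 2 + t + c))
    (he : IsUnit N → e = 1) : IsSpecialOfType Q L (2 * m + 3) N e := by
  set ε := if e = 1 then 0 else c with ε_eq
  have hε : ε = 0 ∨ ε = c ∧ ¬ IsUnit N := by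
    by_cases he1 : e = 1
    · exact .inl (if_pos he1)
    · exact .inr ⟨if_neg he1, mt he he1⟩
  have hδ := isUnit_one_sub_four_mul_of_eq_zero_or_eq hc (hε.imp_right And.left)
  have gram : HasGramDet (integralForm Q h) ((-1) ^ (m + 1) * (2 * N)) :=
    (hasGramDet_modelForm m hδ N).of_equivalent hq.symm
  have regular := gram.polarBilin_nondegenerate (by simp [h2, hN])
  have rank : finrank k V = 2 * m + 3 := by
    obtain ⟨φ⟩ := hq
    rw [← finrank_isLattice L, φ.toLinearEquiv.finrank_eq, finrank_modelForm_module]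
  have cyclic := (isUnimodular_evenForm m hδ).hasCyclicDiscriminant_prod_smul_sq ((1 - 4 * ε) * N)
  have eichler :=
    eichlerInvariant_eq_one_iff_of_equivalent_modelForm regular h h2 hN hc hε hq.symm
  refine ⟨⟨regular, inferInstance, h, rank ▸ ⟨m + 1, by ring⟩,
    (hasCyclicDiscriminant_integralForm_iff regular h).1 (cyclic.of_equivalent hq.symm)⟩,
    rank, (hasDet_two_mul_algebraMap_iff h rank).2 gram, ?_⟩
  have c_ne_zero : c ≠ 0 := fun hc0 => not_isUnit_zero (M₀ := R) (by simpa [hc0] using hc 0)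
  have ε_eq_zero_iff : ε = 0 ↔ e = 1 := by simp [ε_eq, c_ne_zero]
  have eq_of_eq_one_iff : ∀ e e' : ℤˣ, (e = 1 ↔ e' = 1) → e = e' := by decide
  exact eq_of_eq_one_iff _ _ (eichler.trans ε_eq_zero_iff)

end Classification

open IsLocalRing in
theorem henselianLocalRing_integer (k : Type*) [Field k] [ValuativeRel k] [TopologicalSpace k]
    [IsNonarchimedeanLocalField k] : HenselianLocalRing 𝒪[k] := by
  let := IsTopologicalAddGroup.rightUniformSpace k
  have := isUniformAddGroup_of_addCommGroup (G := k)
  have : HenselianRing 𝒪[k] 𝓂[k] := inferInstance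
  exact { is_henselian := fun f hf a h1 h2 => this.is_henselian f hf a h1 (by
    rw [← residue_ne_zero_iff_isUnit] at h2
    exact IsUnit.mk0 _ h2) }

end QuadraticLattice

theorem mainTheorem9_general {R k : Type*} [CommRing R] [IsDomain R] [IsPrincipalIdealRing R]
    [HenselianLocalRing R] [Finite (IsLocalRing.ResidueField R)]
    [Field k] [Algebra R k] [IsFractionRing R k] (hk : (2 : k) ≠ 0)
    (n : ℕ) (hn : 1 ≤ n) (N : R) (hN : N ≠ 0) (e : ℤˣ) (he : IsUnit N → e = 1) :
    (∀ (V : Type u) [AddCommGroup V] [Module R V] [Module k V] [IsScalarTower R k V],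
      Module.finrank k V = 2 * n + 1 → ∃ (Q : QuadraticForm k V) (L : Submodule R V),
        QuadraticLattice.IsSpecialOfType Q L (2 * n + 1) N e) ∧
    (∀ (V : Type v) (W : Type w)
      [AddCommGroup V] [Module R V] [Module k V] [IsScalarTower R k V]
      [AddCommGroup W] [Module R W] [Module k W] [IsScalarTower R k W]
      (Q : QuadraticForm k V) (L : Submodule R V)
      (P : QuadraticForm k W) (M : Submodule R W),
      QuadraticLattice.IsSpecialOfType Q L (2 * n + 1) N e →
      QuadraticLattice.IsSpecialOfType P M (2 * n + 1) N e →
      QuadraticLattice.Isometric Q L P M) := by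
  obtain ⟨m, rfl⟩ := Nat.exists_eq_add_of_le' hn
  have h2 : (2 : R) ≠ 0 := fun h => hk <| by
    rw [← map_ofNat (algebraMap R k), h, map_zero]
  obtain ⟨c, hc⟩ := QuadraticLattice.exists_forall_isUnit_sq_add_self_add R
  refine ⟨fun V _ _ _ _ hV => ?_, fun V W _ _ _ _ _ _ _ _ Q L P M hQ hP => ?_⟩
  · have := Module.finite_of_finrank_eq_succ hV
    obtain ⟨Q, L, integral, isLattice, hq⟩ :=
      QuadraticLattice.exists_isLattice_integralForm_equivalent
        ((QuadraticLattice.finrank_modelForm_module R m).trans hV.symm)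
        (QuadraticLattice.modelForm m (if e = 1 then 0 else c) N)
    exact ⟨Q, L, QuadraticLattice.isSpecialOfType_of_equivalent_modelForm hq h2 hN hc he⟩
  · have := hQ.1.isLattice
    have := hP.1.isLattice
    exact QuadraticLattice.isometric_of_equivalent_integralForm <|
      (hQ.equivalent_modelForm h2 hN hc).trans (hP.equivalent_modelForm h2 hN hc).symm

theorem mainTheorem9 {k : Type u} [Field k] [ValuativeRel k] [TopologicalSpace k]
    [IsNonarchimedeanLocalField k] (hk : (2 : k) ≠ 0)
    (n : ℕ) (hn : 1 ≤ n) (N : 𝒪[k]) (hN : N ≠ 0) (e : ℤˣ) (he : IsUnit N → e = 1) :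
    (∃ (V : Type u) (_ : AddCommGroup V) (_ : Module k V)
      (Q : QuadraticForm k V) (L : Submodule 𝒪[k] V),
      QuadraticLattice.IsSpecialOfType Q L (2 * n + 1) N e) ∧
    (∀ (V : Type v) (W : Type w) [AddCommGroup V] [Module k V] [AddCommGroup W] [Module k W]
      (Q : QuadraticForm k V) (L : Submodule 𝒪[k] V)
      (P : QuadraticForm k W) (M : Submodule 𝒪[k] W),
      QuadraticLattice.IsSpecialOfType Q L (2 * n + 1) N e →
      QuadraticLattice.IsSpecialOfType P M (2 * n + 1) N e →
      QuadraticLattice.Isometric Q L P M) := by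
  have := QuadraticLattice.henselianLocalRing_integer k
  have := mainTheorem9_general (R := 𝒪[k]) hk n hn N hN e he
  exact ⟨⟨Fin (2 * n + 1) → k, inferInstance, inferInstance, this.1 _ (by simp)⟩,
    fun V W _ _ _ _ => this.2 V W⟩
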